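/- Let $q$ be a prime power and let $F=\mathbb F_{q^2}(\mathscr H)=\mathbb F_{q^2}(x,y)$, $x^{q+1}=y^q+y$, be the function field of the Hermitian curve $\mathscr H$ over $\mathbb F_{q^2}$. Let $P_\infty$ be a place of $F$ of degree one, let $P$ be a place of $F$ of degree $3$, and let $D$ be the sum of all places of degree one of $F$ other than $P_\infty$. For a divisor $G$ whose support is disjoint from that of $D$, let $$C_L(D,G)=\{(f(Q))_{Q\in\operatorname{supp} D} \mid f\in \mathscr L(G)\},\qquad \mathscr L(G)=\{f\in F\setminus\{0\}\mid \operatorname{div}(f)\succeq -G\}\cup\{0\},$$ be the functional code. Let $m=m_1(q+1)+m_0$ with integers $m_1\ge 0$ and $0\le m_0\le q$, and put $$A_1=(q^3+q^2-q-2)P_\infty-mP,\qquad A_2=(q^2-3m_1-1)(q+1)P_\infty-(P_\infty+m_0P).$$ Then the codes $C_L(D,A_1)$ and $C_L(D,A_2)$ over $\mathbb F_{q^2}$ are monomially equivalent, i.e. one is obtained from the other by a permutation of the coordinates followed by multiplication of each coordinate by a nonzero element of $\mathbb F_{q^2}$. -/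

import Mathlib

open scoped WithZero Polynomial

noncomputable section

/-- A place of the field extension `F / k`, given by its normalized discrete valuation:
a surjective valuation of `F` with value group `ℤ` (written multiplicatively, with a zero),
which is trivial on the constants `k`. -/
@[ext]
structure Place (k F : Type*) [Field k] [Field F] [Algebra k F] where
  val : Valuation F ℤᵐ⁰
  surjective : Function.Surjective val
  trivial : ∀ c : k, c ≠ 0 → val (algebraMap k F c) = 1

namespace Place

variable {k F : Type*} [Field k] [Field F] [Algebra k F]

/-- The order `v_Q(f)` of a nonzero function `f` at the place `Q`
(positive at zeros, negative at poles). -/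
def ord (Q : Place k F) (f : F) : ℤ := -WithZero.log (Q.val f)

lemma val_algebraMap_le (Q : Place k F) (c : k) : Q.val (algebraMap k F c) ≤ 1 := by
  by_cases h : c = 0
  · simp [h]
  · exact (Q.trivial c h).le

/-- The valuation ring `O_Q` of a place. -/
abbrev integers (Q : Place k F) : ValuationSubring F := Q.val.valuationSubring

/-- The constants embed in the valuation ring. -/
instance (Q : Place k F) : Algebra k Q.integers :=
  ((algebraMap k F).codRestrict Q.integers.toSubring Q.val_algebraMap_le).toAlgebra

/-- The residue field `O_Q / m_Q` of a place. -/
abbrev residueField (Q : Place k F) : Type _ := IsLocalRing.ResidueField Q.integers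

/-- The degree of a place: the dimension over `k` of its residue field. -/
def degree (Q : Place k F) : ℕ := Module.finrank k Q.residueField

/-- `f(Q) = c`: the function `f` is regular at `Q` and its residue class is the constant `c`.
If `Q` has degree one, every `f` regular at `Q` has exactly one such value `c` in `k`. -/
def HasValue (Q : Place k F) (f : F) (c : k) : Prop :=
  ∃ h : f ∈ Q.integers, IsLocalRing.residue Q.integers ⟨f, h⟩ = algebraMap k Q.residueField c

lemma HasValue.add {Q : Place k F} {f g : F} {a b : k} (hf : Q.HasValue f a)
    (hg : Q.HasValue g b) : Q.HasValue (f + g) (a + b) := by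
  obtain ⟨h, e⟩ := hf
  obtain ⟨h', e'⟩ := hg
  refine ⟨add_mem h h', ?_⟩
  rw [map_add, ← e, ← e', ← map_add]
  rfl

lemma HasValue.smul {Q : Place k F} {f : F} {a : k} (c : k) (hf : Q.HasValue f a) :
    Q.HasValue (c • f) (c * a) := by
  obtain ⟨h, e⟩ := hf
  have hc : algebraMap k F c ∈ Q.integers := Q.val_algebraMap_le c
  refine ⟨by rw [Algebra.smul_def]; exact mul_mem hc h, ?_⟩
  have h1 : algebraMap k Q.residueField c = IsLocalRing.residue Q.integers ⟨_, hc⟩ := rfl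
  rw [map_mul, ← e, h1, ← map_mul]
  congr 1
  exact Subtype.ext (Algebra.smul_def c f)

lemma HasValue.zero (Q : Place k F) : Q.HasValue (0 : F) (0 : k) :=
  ⟨zero_mem _, by rw [map_zero]; exact map_zero _⟩

end Place

/-- Divisors of `F / k`: finite formal integer combinations of places. -/
abbrev PlaceDivisor (k F : Type*) [Field k] [Field F] [Algebra k F] : Type _ := Place k F →₀ ℤ

section Codes

variable {k F : Type*} [Field k] [Field F] [Algebra k F]

/-- The Riemann-Roch space `L(A) = {f ≠ 0 | div f ≥ -A} ∪ {0}`. -/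
def riemannRochSpace (A : PlaceDivisor k F) : Submodule k F where
  carrier := {f | f ≠ 0 → ∀ Q : Place k F, -A Q ≤ Q.ord f}
  zero_mem' := fun h => absurd rfl h
  add_mem' := by
    intro f g hf hg hfg Q
    by_cases f0 : f = 0
    · subst f0
      rw [zero_add] at hfg ⊢
      exact hg hfg Q
    by_cases g0 : g = 0
    · subst g0
      rw [add_zero] at hfg ⊢
      exact hf hfg Q
    have h1 := hf f0 Q
    have h2 := hg g0 Q
    have vf : Q.val f ≠ 0 := by simpa using f0
    have vg : Q.val g ≠ 0 := by simpa using g0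
    have vs : Q.val (f + g) ≠ 0 := by simpa using hfg
    unfold Place.ord at *
    rcases le_max_iff.1 (Q.val.map_add f g) with h | h
    · have := (WithZero.log_le_log vs vf).2 h
      omega
    · have := (WithZero.log_le_log vs vg).2 h
      omega
  smul_mem' := by
    intro c f hf hcf Q
    have c0 : c ≠ 0 := by
      rintro rfl
      simp at hcf
    have f0 : f ≠ 0 := by
      rintro rfl
      simp at hcf
    have := hf f0 Q
    unfold Place.ord at *
    rw [Algebra.smul_def, map_mul, Q.trivial c c0, one_mul]
    exact this

/-- The functional code `C_L(D, G)`, where `D` is the sum of the places in the set `S`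
(in the intended use these are finitely many places of degree one, outside the support of `G`):
all words `(f(Q))_{Q ∈ S}` with `f ∈ L(G)`. Coordinates are indexed by the places in `S`. -/
def functionalCode (S : Set (Place k F)) (G : PlaceDivisor k F) : Submodule k (S → k) where
  carrier := {c | ∃ f ∈ riemannRochSpace G, ∀ Q : S, Q.1.HasValue f (c Q)}
  zero_mem' := ⟨0, zero_mem _, fun Q => Place.HasValue.zero Q.1⟩
  add_mem' := by
    rintro a b ⟨f, hf, ha⟩ ⟨g, hg, hb⟩
    exact ⟨f + g, add_mem hf hg, fun Q => (ha Q).add (hb Q)⟩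
  smul_mem' := by
    rintro r a ⟨f, hf, ha⟩
    exact ⟨r • f, Submodule.smul_mem _ r hf, fun Q => (ha Q).smul r⟩

end Codes

/-- Two linear codes with the same index set of coordinates are monomially equivalent if one is
obtained from the other by permuting coordinates and multiplying each coordinate by a nonzero
scalar. -/
def MonomiallyEquivalent {k ι : Type*} [Field k] (C₁ C₂ : Submodule k (ι → k)) : Prop :=
  ∃ (σ : Equiv.Perm ι) (u : ι → kˣ),
    ∀ c : ι → k, c ∈ C₁ ↔ (fun i => (u i : k) * c (σ i)) ∈ C₂

namespace Hermitian

/-- The affine equation `x ^ (q + 1) - (y ^ q + y)` of the Hermitian curve, as a polynomial in the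
outer variable `x` with coefficients in `k[y]`. -/
def equation (q : ℕ) (k : Type*) [Field k] : k[X][X] :=
  Polynomial.X ^ (q + 1) - Polynomial.C (Polynomial.X ^ q + Polynomial.X)

lemma prime_equation (q : ℕ) (k : Type*) [Field k] (hq : 2 ≤ q) : Prime (equation q k) := by
  have hdeg : (equation q k).natDegree = q + 1 := Polynomial.natDegree_X_pow_sub_C
  have hmon : (equation q k).Monic := Polynomial.monic_X_pow_sub_C _ (by omega)
  have hP : (Ideal.span {(Polynomial.X : k[X])}).IsPrime :=
    (Ideal.span_singleton_prime Polynomial.X_ne_zero).2 Polynomial.prime_X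
  have key : (equation q k).IsEisensteinAt (Ideal.span {(Polynomial.X : k[X])}) := by
    refine ⟨?_, ?_, ?_⟩
    · rw [hmon.leadingCoeff]
      exact fun h => hP.ne_top ((Ideal.eq_top_iff_one _).2 h)
    · intro n hn
      rw [hdeg] at hn
      rw [Ideal.mem_span_singleton, equation, Polynomial.coeff_sub, Polynomial.coeff_X_pow,
        if_neg (by omega), Polynomial.coeff_C, zero_sub, dvd_neg]
      split_ifs
      · exact dvd_add (dvd_pow_self _ (by omega)) dvd_rfl
      · exact dvd_zero _
    · rw [Ideal.span_singleton_pow, Ideal.mem_span_singleton, equation, Polynomial.coeff_sub,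
        Polynomial.coeff_X_pow, if_neg (by omega), Polynomial.coeff_C_zero, zero_sub, dvd_neg,
        Polynomial.X_pow_dvd_iff]
      intro h
      have := h 1 (by omega)
      rw [Polynomial.coeff_add, Polynomial.coeff_X_pow, if_neg (by omega),
        Polynomial.coeff_X_one] at this
      simp at this
  exact (key.irreducible hP hmon.isPrimitive (by omega)).prime

/-- The affine coordinate ring `k[x, y] / (x ^ (q + 1) - y ^ q - y)` of the Hermitian curve. -/
abbrev CoordinateRing (q : ℕ) (k : Type*) [Field k] : Type _ := AdjoinRoot (equation q k)

instance (q : ℕ) (k : Type*) [Field k] [hq : Fact (IsPrimePow q)] :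
    IsDomain (CoordinateRing q k) :=
  AdjoinRoot.isDomain_of_prime (prime_equation q k hq.out.two_le)

/-- The function field `k(x, y)`, `x ^ (q + 1) = y ^ q + y`, of the Hermitian curve. -/
abbrev FunctionField (q : ℕ) (k : Type*) [Field k] : Type _ := FractionRing (CoordinateRing q k)

end Hermitian

end

/-! The two divisors differ by a principal one: A₁ - A₂ = -m₁ (q + 1) (P - 3 P_∞), and (q + 1) (P -
3 P_∞) = div f for some f. Multiplication by f ^ (-m₁) maps L(A₁) onto L(A₂) and, as f is a unit at
every evaluation place, only rescales coordinates.

To construct f, choose coordinates in which P_∞ is the place at infinity. Over the algebraic closure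
P splits into three points permuted by the q²-Frobenius. The tangent at (a, b), namely L = y + b^q -
a^q x, satisfies L^q + L = (x - a)^q (x - a^(q²)) (`tangent_identity`), so it meets the curve q
times at (a, b) and once at the Frobenius image. The product of the three tangents is a cubic over
k, with order q + 1 at P, a pole of order 3 (q + 1) at P_∞, and no other zero or pole.

Orders are computed directly with valuations. At an affine place of degree d, u = x - x^(q^(2d)) is
a uniformizer, because a divisibility in the coordinate ring lets u be split off any function
vanishing there (`HermitianCoords.exists_dvd`, `Place.IsAffineAt.exists_factor`). To find the order
at P without extending constants, the conjugate coefficients are approximated inside F by high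
Frobenius powers of x and y (`Place.val_tangents`, `Place.val_cubicForm_self`). -/

/-! ### Frobenius powers and descent to the finite constant field. -/

section Frobenius

variable {q : ℕ} {k : Type*} [Field k] [Fintype k]

/-- Over a field with `q ^ 2` elements, raising to the power `q ^ j` is a ring homomorphism. -/
lemma exists_ringHom_pow (hq : IsPrimePow q) (hk : Fintype.card k = q ^ 2) (R : Type*)
    [CommRing R] [Nontrivial R] [Algebra k R] (j : ℕ) :
    ∃ φ : R →+* R, ∀ x, φ x = x ^ (q ^ j) := by
  obtain ⟨p, n, hp, hn, rfl⟩ := hq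
  have hp' : p.Prime := hp.nat_prime
  obtain ⟨l, hl⟩ := CharP.exists k
  obtain ⟨e, hlp, he⟩ := FiniteField.card k l
  have hlp' : l = p := by
    rw [hk] at he
    have : l ∣ (p ^ n) ^ 2 := he ▸ dvd_pow_self l e.pos.ne'
    exact (Nat.prime_dvd_prime_iff_eq hlp hp').1
      (hlp.dvd_of_dvd_pow (hlp.dvd_of_dvd_pow this))
  subst hlp'
  have : Fact l.Prime := ⟨hlp⟩
  have : CharP R l := charP_of_injective_algebraMap (algebraMap k R).injective l
  exact ⟨iterateFrobenius R l (n * j), fun x => by rw [iterateFrobenius_def, pow_mul]⟩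

lemma algebraMap_pow_card_pow (hk : Fintype.card k = q ^ 2) {R : Type*} [CommRing R] [Algebra k R]
    (d : ℕ) (c : k) : (algebraMap k R c) ^ (q ^ (2 * d)) = algebraMap k R c := by
  rw [← map_pow, pow_mul, ← hk, FiniteField.pow_card_pow]

/-- The polynomial X^|k| - X already splits over k, so an extension field contains no further roots.
-/
lemma exists_algebraMap_of_pow_card {K : Type*} [Field K] [Algebra k K] {z : K}
    (hz : z ^ Fintype.card k = z) : ∃ c : k, algebraMap k K c = z := by
  classical
  have h := FiniteField.roots_X_pow_card_sub_X k
  have hs : (Polynomial.X ^ Fintype.card k - Polynomial.X : k[X]).Splits := by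
    rw [Polynomial.splits_iff_card_roots, h,
      FiniteField.X_pow_card_sub_X_natDegree_eq _ Fintype.one_lt_card]
    rfl
  have hm : (Polynomial.X ^ Fintype.card k - Polynomial.X : k[X]) ≠ 0 :=
    FiniteField.X_pow_card_sub_X_ne_zero _ Fintype.one_lt_card
  have hz0 : Polynomial.aeval z (Polynomial.X ^ Fintype.card k - Polynomial.X : k[X]) = 0 := by
    simp [hz]
  obtain ⟨c, hc⟩ := hs.mem_range_of_isRoot hm (x := z) (i := algebraMap k K) (by
    rwa [Polynomial.IsRoot.def, Polynomial.eval_map_algebraMap])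
  exact ⟨c, hc⟩

end Frobenius

/-! ### Hermitian coordinates: symmetries of the curve and a divisibility. -/

/-- `x` and `y` generate `F` over `k` and satisfy the Hermitian equation. -/
structure HermitianCoords (k : Type*) {F : Type*} [Field k] [Field F] [Algebra k F] (q : ℕ)
    (x y : F) : Prop where
  eqn : x ^ (q + 1) = y ^ q + y
  top : IntermediateField.adjoin k {x, y} = ⊤

namespace HermitianCoords

variable {q : ℕ} {k F : Type*} [Field k] [Field F] [Algebra k F] {x y : F}

lemma of_mem {x' y' : F} (h : HermitianCoords k q x y) (e : x' ^ (q + 1) = y' ^ q + y')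
    (hx : x ∈ IntermediateField.adjoin k {x', y'}) (hy : y ∈ IntermediateField.adjoin k {x', y'}) :
    HermitianCoords k q x' y' := by
  refine ⟨e, top_unique ?_⟩
  rw [← h.top, IntermediateField.adjoin_le_iff]
  rintro z (rfl | rfl)
  · exact hx
  · exact hy

lemma exists_div (h : HermitianCoords k q x y) (z : F) :
    ∃ f ∈ Algebra.adjoin k {x, y}, ∃ g ∈ Algebra.adjoin k {x, y}, z = f / g :=
  IntermediateField.mem_adjoin_iff_div.1 (h.top ▸ IntermediateField.mem_top)

/-- The projective automorphism of the curve exchanging the origin and the place at infinity. -/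
lemma inv (h : HermitianCoords k q x y) (hy : y ≠ 0) : HermitianCoords k q (x / y) (1 / y) := by
  have hY : 1 / y ∈ IntermediateField.adjoin k {x / y, 1 / y} :=
    IntermediateField.subset_adjoin _ _ (by simp)
  have hX : x / y ∈ IntermediateField.adjoin k {x / y, 1 / y} :=
    IntermediateField.subset_adjoin _ _ (by simp)
  refine h.of_mem ?_ ?_ ?_
  · rw [div_pow, div_pow, one_pow, h.eqn]
    field_simp
    ring
  · simpa [hy] using div_mem hX hY
  · simpa using inv_mem hY

/-- Translation of the curve moving the rational point `(a, b)` to the origin. -/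
lemma translate (hq : IsPrimePow q) [Fintype k] (hk : Fintype.card k = q ^ 2) (h : HermitianCoords k q x y)
    {a b : k} (hab : a ^ (q + 1) = b ^ q + b) :
    HermitianCoords k q (x - algebraMap k F a)
      (y + algebraMap k F b ^ q - algebraMap k F a ^ q * x) := by
  set A := algebraMap k F a with hA
  set B := algebraMap k F b with hB
  have hX : x - A ∈ IntermediateField.adjoin k {x - A, y + B ^ q - A ^ q * x} :=
    IntermediateField.subset_adjoin _ _ (by simp)
  have hY : y + B ^ q - A ^ q * x ∈ IntermediateField.adjoin k {x - A, y + B ^ q - A ^ q * x} :=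
    IntermediateField.subset_adjoin _ _ (by simp)
  have hAm : A ∈ IntermediateField.adjoin k {x - A, y + B ^ q - A ^ q * x} :=
    IntermediateField.algebraMap_mem _ _
  have hBm : B ∈ IntermediateField.adjoin k {x - A, y + B ^ q - A ^ q * x} :=
    IntermediateField.algebraMap_mem _ _
  have hx : x ∈ IntermediateField.adjoin k {x - A, y + B ^ q - A ^ q * x} := by
    simpa using add_mem hX hAm
  refine h.of_mem ?_ hx ?_
  · obtain ⟨φ, hφ⟩ := exists_ringHom_pow hq hk F 1
    simp only [pow_one] at hφ
    have hAA : (A ^ q) ^ q = A := by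
      rw [← pow_mul, ← sq]; simpa using algebraMap_pow_card_pow hk (R := F) 1 a
    have hBB : (B ^ q) ^ q = B := by
      rw [← pow_mul, ← sq]; simpa using algebraMap_pow_card_pow hk (R := F) 1 b
    have hAB : A ^ (q + 1) = B ^ q + B := by rw [hA, hB, ← map_pow, hab]; simp
    have e := h.eqn
    rw [← hφ (y + B ^ q - A ^ q * x), map_sub, map_add, map_mul, hφ, hφ, hφ, hφ, hAA, hBB,
      pow_succ, ← hφ (x - A), map_sub, hφ, hφ]
    rw [pow_succ] at e hAB
    linear_combination e + hAB
  · have := sub_mem (add_mem hY (mul_mem (pow_mem hAm q) hx)) (pow_mem hBm q)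
    simpa using this

/-- With r = q^(2d), the map f ↦ f - f^r is additive, kills constants and obeys a twisted Leibniz
rule, so only the generators matter. For y, the curve equation gives w^q + w = u x^q + x^r u^q,
where u = x - x^r and w = y - y^r. The factor 1 + w^(q-1) is a unit wherever w vanishes. -/
lemma exists_dvd (hq : IsPrimePow q) [Fintype k] (hk : Fintype.card k = q ^ 2)
    (e : x ^ (q + 1) = y ^ q + y) (d : ℕ) {f : F}
    (hf : f ∈ Algebra.adjoin k {x, y}) :
    ∃ g ∈ Algebra.adjoin k {x, y},
      (1 + (y - y ^ q ^ (2 * d)) ^ (q - 1)) * (f - f ^ q ^ (2 * d)) =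
        (x - x ^ q ^ (2 * d)) * g := by
  have hx : x ∈ Algebra.adjoin k {x, y} := Algebra.subset_adjoin (by simp)
  have hy : y ∈ Algebra.adjoin k {x, y} := Algebra.subset_adjoin (by simp)
  obtain ⟨φ, hφ⟩ := exists_ringHom_pow hq hk F (2 * d)
  obtain ⟨ψ, hψ⟩ := exists_ringHom_pow hq hk F 1
  simp only [pow_one] at hψ
  have hq1 : q - 1 + 1 = q := Nat.sub_add_cancel hq.one_lt.le
  set r := q ^ (2 * d)
  set u := x - x ^ r with hu
  set w := y - y ^ r with hw
  have hum : u ∈ Algebra.adjoin k {x, y} := sub_mem hx (pow_mem hx _)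
  have hwm : w ∈ Algebra.adjoin k {x, y} := sub_mem hy (pow_mem hy _)
  induction hf using Algebra.adjoin_induction with
  | mem z hz =>
    rcases hz with rfl | rfl
    · refine ⟨1 + w ^ (q - 1), add_mem (one_mem _) (pow_mem hwm _), ?_⟩
      rw [← hu]; ring
    · refine ⟨x ^ q + x ^ r * u ^ (q - 1),
        add_mem (pow_mem hx _) (mul_mem (pow_mem hx _) (pow_mem hum _)), ?_⟩
      have h1 : (1 + w ^ (q - 1)) * w = w ^ q + w := by
        conv_rhs => rw [← hq1, pow_succ]
        ring
      have h2 : u * (x ^ q + x ^ r * u ^ (q - 1)) = u * x ^ q + x ^ r * u ^ q := by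
        conv_rhs => rw [← hq1, pow_succ u]
        rw [hq1]; ring
      have h3 : (x ^ r) ^ q * x ^ r = (z ^ r) ^ q + z ^ r := by
        rw [← pow_succ, ← pow_mul, mul_comm, pow_mul, e, ← hφ, map_add, hφ, hφ]
        ring
      rw [← hw, h1, h2, ← hψ w, ← hψ u, hw, hu, map_sub, map_sub, hψ, hψ, hψ, hψ]
      rw [pow_succ] at e
      linear_combination -e + h3
  | algebraMap c => exact ⟨0, zero_mem _, by rw [algebraMap_pow_card_pow hk]; ring⟩
  | add f g _ _ h1 h2 =>
    obtain ⟨g1, hg1, e1⟩ := h1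
    obtain ⟨g2, hg2, e2⟩ := h2
    refine ⟨g1 + g2, add_mem hg1 hg2, ?_⟩
    rw [← hφ (f + g), map_add, hφ, hφ]
    linear_combination e1 + e2
  | mul f g hf hg h1 h2 =>
    obtain ⟨g1, hg1, e1⟩ := h1
    obtain ⟨g2, hg2, e2⟩ := h2
    refine ⟨g1 * g + f ^ r * g2, add_mem (mul_mem hg1 hg) (mul_mem (pow_mem hf _) hg2), ?_⟩
    rw [mul_pow]
    linear_combination g * e1 + f ^ r * e2

end HermitianCoords

/-! ### Residues, values and degrees of places. -/

namespace Place

section Residue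

variable {k F : Type*} [Field k] [Field F] [Algebra k F]

lemma residue_eq_zero_iff (Q : Place k F) (z : Q.integers) :
    IsLocalRing.residue Q.integers z = 0 ↔ Q.val (z : F) < 1 := by
  rw [IsLocalRing.residue_eq_zero_iff, Valuation.mem_maximalIdeal_iff]

lemma hasValue_iff (Q : Place k F) {f : F} {c : k} :
    Q.HasValue f c ↔ Q.val f ≤ 1 ∧ Q.val (f - algebraMap k F c) < 1 := by
  have key : ∀ h : f ∈ Q.integers, IsLocalRing.residue Q.integers ⟨f, h⟩ =
      algebraMap k Q.residueField c ↔ Q.val (f - algebraMap k F c) < 1 := by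
    intro h
    have : algebraMap k Q.residueField c =
      IsLocalRing.residue Q.integers ⟨algebraMap k F c, Q.val_algebraMap_le c⟩ := rfl
    rw [this, ← sub_eq_zero, ← map_sub, residue_eq_zero_iff]
    rfl
  exact ⟨fun ⟨h, e⟩ => ⟨h, (key h).1 e⟩, fun ⟨h, e⟩ => ⟨h, (key h).2 e⟩⟩

lemma exists_val_sub_lt {Q : Place k F} (hQ : Q.degree = 1) {f : F} (hf : Q.val f ≤ 1) :
    ∃ c : k, Q.val (f - algebraMap k F c) < 1 := by
  have hs : Function.Surjective (algebraMap k Q.residueField) := by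
    have := Subalgebra.bot_eq_top_of_finrank_eq_one (F := k) (E := Q.residueField) hQ
    exact (Algebra.surjective_algebraMap_iff).2 this.symm
  obtain ⟨c, hc⟩ := hs (IsLocalRing.residue Q.integers ⟨f, hf⟩)
  exact ⟨c, (Q.hasValue_iff.1 ⟨hf, hc.symm⟩).2⟩

lemma degree_eq_one (Q : Place k F)
    (h : ∀ f, Q.val f ≤ 1 → ∃ c : k, Q.val (f - algebraMap k F c) < 1) : Q.degree = 1 := by
  have hs : Function.Surjective (algebraMap k Q.residueField) := by
    intro z
    obtain ⟨⟨f, hf⟩, rfl⟩ := IsLocalRing.residue_surjective z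
    obtain ⟨c, hc⟩ := h f hf
    exact ⟨c, (Q.hasValue_iff.2 ⟨hf, hc⟩).choose_spec.symm⟩
  rw [degree, finrank_eq_one_iff_of_nonzero' (1 : Q.residueField) one_ne_zero]
  intro w
  obtain ⟨c, rfl⟩ := hs w
  exact ⟨c, (Algebra.algebraMap_eq_smul_one c).symm⟩

lemma val_algebraMap_lt_one_iff (Q : Place k F) {c : k} :
    Q.val (algebraMap k F c) < 1 ↔ c = 0 := by
  refine ⟨fun h => ?_, fun h => by simp [h]⟩
  by_contra h0
  exact h.ne (Q.trivial c h0)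

/-- Positivity of d excludes the default value 0 of `finrank` in infinite dimension, so the residue
field is finite with q^(2d) elements. -/
lemma pow_card_residue [Fintype k] {q d : ℕ} (hk : Fintype.card k = q ^ 2) (Q : Place k F)
    (hd : 0 < d) (hQ : Q.degree = d) (z : Q.residueField) : z ^ q ^ (2 * d) = z := by
  have : Module.Finite k Q.residueField := Module.finite_of_finrank_pos (by
    rw [degree] at hQ; omega)
  have : Finite Q.residueField := Module.finite_of_finite k
  have : Fintype Q.residueField := Fintype.ofFinite _
  have h := Module.card_eq_pow_finrank (K := k) (V := Q.residueField)
  rw [degree] at hQ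
  rw [hQ, hk, ← pow_mul] at h
  rw [← h, FiniteField.pow_card]

lemma val_sub_pow_lt [Fintype k] {q d : ℕ} (hk : Fintype.card k = q ^ 2) (Q : Place k F)
    (hd : 0 < d) (hQ : Q.degree = d) {f : F} (hf : Q.val f ≤ 1) :
    Q.val (f - f ^ q ^ (2 * d)) < 1 := by
  have h := pow_card_residue hk Q hd hQ (IsLocalRing.residue Q.integers ⟨f, hf⟩)
  rw [eq_comm, ← map_pow, ← sub_eq_zero, ← map_sub, residue_eq_zero_iff] at h
  exact h

lemma val_le_one_of_mem_adjoin (Q : Place k F) {x y : F} (hx : Q.val x ≤ 1) (hy : Q.val y ≤ 1)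
    {f : F} (hf : f ∈ Algebra.adjoin k {x, y}) : Q.val f ≤ 1 := by
  induction hf using Algebra.adjoin_induction with
  | mem z hz => rcases hz with rfl | rfl <;> assumption
  | algebraMap c => exact Q.val_algebraMap_le c
  | add f g _ _ h1 h2 => exact Q.val.map_add_le h1 h2
  | mul f g _ _ h1 h2 => rw [map_mul]; exact mul_le_one' h1 h2

/-- The coordinates `x, y` are regular at `Q`, and their residues are fixed by `z ↦ z ^ r`. -/
structure IsAffineAt (Q : Place k F) (x y : F) (r : ℕ) : Prop where
  x_le : Q.val x ≤ 1
  y_le : Q.val y ≤ 1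
  x_sub : Q.val (x - x ^ r) < 1
  y_sub : Q.val (y - y ^ r) < 1

lemma isAffineAt_of_degree [Fintype k] {q d : ℕ} (hk : Fintype.card k = q ^ 2) {Q : Place k F}
    (hd : 0 < d) (hQ : Q.degree = d) {x y : F} (hx : Q.val x ≤ 1) (hy : Q.val y ≤ 1) :
    Q.IsAffineAt x y (q ^ (2 * d)) :=
  ⟨hx, hy, val_sub_pow_lt hk Q hd hQ hx, val_sub_pow_lt hk Q hd hQ hy⟩

end Residue

/-! ### The uniformizer x - x^(q^(2d)) at an affine place. -/

section Local

variable {q d : ℕ} {k F : Type*} [Field k] [Field F] [Algebra k F] {x y : F}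

/-- If f vanishes at Q, then f - f^r is f times a unit, so `HermitianCoords.exists_dvd` splits off
one factor u = x - x^r and leaves a cofactor in the coordinate ring of smaller order. Iterating
stops because the order of f is finite. -/
lemma IsAffineAt.exists_factor (hq : IsPrimePow q) [Fintype k] (hk : Fintype.card k = q ^ 2)
    (e : x ^ (q + 1) = y ^ q + y) (hd : 0 < d) {Q : Place k F}
    (hQ : Q.IsAffineAt x y (q ^ (2 * d))) {f : F} (hf : f ∈ Algebra.adjoin k {x, y})
    (hf0 : f ≠ 0) :
    ∃ n : ℕ, ∃ s ∈ Algebra.adjoin k {x, y}, ∃ g ∈ Algebra.adjoin k {x, y},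
      Q.val s = 1 ∧ Q.val g = 1 ∧ s * f = (x - x ^ q ^ (2 * d)) ^ n * g := by
  have hx : x ∈ Algebra.adjoin k {x, y} := Algebra.subset_adjoin (by simp)
  have hy : y ∈ Algebra.adjoin k {x, y} := Algebra.subset_adjoin (by simp)
  have hr : 2 ≤ q ^ (2 * d) := by
    calc 2 ≤ q := hq.two_le
      _ ≤ q ^ (2 * d) := Nat.le_self_pow (by omega) q
  have hq2 := hq.two_le
  -- N bounds the order of f and drives the induction.
  obtain ⟨N, hN⟩ := WithZero.exists_exp_neg_natCast_lt (Q.val.ne_zero_iff.2 hf0)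
  replace hN := hN.le
  induction N generalizing f with
  | zero =>
    refine ⟨0, 1, one_mem _, f, hf, map_one _, ?_, by ring⟩
    exact le_antisymm (Q.val_le_one_of_mem_adjoin hQ.x_le hQ.y_le hf) (by simpa using hN)
  | succ N ih =>
    rcases (Q.val_le_one_of_mem_adjoin hQ.x_le hQ.y_le hf).lt_or_eq with h1 | h1
    swap
    · exact ⟨0, 1, one_mem _, f, hf, map_one _, h1, by ring⟩
    obtain ⟨g, hg, eg⟩ := HermitianCoords.exists_dvd hq hk e d hf
    set r := q ^ (2 * d)
    set u := x - x ^ r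
    set w := y - y ^ r
    have hs : f - f ^ r = (1 - f ^ (r - 1)) * f := by
      have : r - 1 + 1 = r := by omega
      conv_lhs => rw [← this, pow_succ]
      ring
    rw [hs, ← mul_assoc] at eg
    set s := (1 + w ^ (q - 1)) * (1 - f ^ (r - 1)) with hsdef
    have hsm : s ∈ Algebra.adjoin k {x, y} :=
      mul_mem (add_mem (one_mem _) (pow_mem (sub_mem hy (pow_mem hy _)) _))
        (sub_mem (one_mem _) (pow_mem hf _))
    have hsv : Q.val s = 1 := by
      rw [hsdef, map_mul, Q.val.map_one_add_of_lt, Q.val.map_one_sub_of_lt, one_mul]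
      · rw [map_pow]; exact pow_lt_one₀ zero_le h1 (by omega)
      · rw [map_pow]; exact pow_lt_one₀ zero_le hQ.y_sub (by omega)
    have hs0 : s ≠ 0 := by rw [← Q.val.ne_zero_iff, hsv]; exact one_ne_zero
    have hug : u * g ≠ 0 := eg ▸ mul_ne_zero hs0 hf0
    have hu0 := left_ne_zero_of_mul hug
    have hg0 := right_ne_zero_of_mul hug
    have hval : Q.val f = Q.val u * Q.val g := by
      rw [← map_mul, ← eg, map_mul, hsv, one_mul]
    have hN' : WithZero.exp (-(N : ℤ)) ≤ Q.val g := by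
      have hvu := Q.val.ne_zero_iff.2 hu0
      have hvg := Q.val.ne_zero_iff.2 hg0
      have hvf := Q.val.ne_zero_iff.2 hf0
      rw [← WithZero.le_log_iff_exp_le hvf, hval, WithZero.log_mul hvu hvg] at hN
      rw [← WithZero.le_log_iff_exp_le hvg]
      have : WithZero.log (Q.val u) < 0 := by
        rw [WithZero.log_lt_iff_lt_exp hvu]; simpa using hQ.x_sub
      push_cast at hN
      omega
    obtain ⟨n, s', hs', g', hg', vs', vg', e'⟩ := ih hg hg0 hN'
    refine ⟨n + 1, s' * s, mul_mem hs' hsm, g', hg', by rw [map_mul, vs', hsv, one_mul], vg', ?_⟩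
    rw [mul_assoc, eg]
    linear_combination u * e'

/-- By `exists_factor` every nonzero element of F has an integral power of the value of u as its
value. Surjectivity of the valuation makes this value a generator of the value group, and u vanishes
at Q. -/
lemma IsAffineAt.val_eq (hq : IsPrimePow q) [Fintype k] (hk : Fintype.card k = q ^ 2)
    (h : HermitianCoords k q x y) (hd : 0 < d) {Q : Place k F}
    (hQ : Q.IsAffineAt x y (q ^ (2 * d))) : Q.val (x - x ^ q ^ (2 * d)) = WithZero.exp (-1) := by
  obtain ⟨t, ht⟩ := Q.surjective (WithZero.exp (-1))
  have ht0 : t ≠ 0 := by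
    rw [← Q.val.ne_zero_iff, ht]; exact WithZero.exp_ne_zero
  obtain ⟨f, hf, g, hg, rfl⟩ := h.exists_div t
  rw [div_ne_zero_iff] at ht0
  obtain ⟨n, s, -, f', -, vs, vf, e1⟩ := hQ.exists_factor hq hk h.eqn hd hf ht0.1
  obtain ⟨m, s', -, g', -, vs', vg, e2⟩ := hQ.exists_factor hq hk h.eqn hd hg ht0.2
  have hu1 := hQ.x_sub
  set u := x - x ^ q ^ (2 * d)
  have h1 : Q.val f = Q.val u ^ n := by
    simpa [vs, vf] using congrArg Q.val e1
  have h2 : Q.val g = Q.val u ^ m := by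
    simpa [vs', vg] using congrArg Q.val e2
  -- If u were 0, both exponents would be 0 and the chosen element t of order one would be a unit.
  have hu : Q.val u ≠ 0 := by
    intro hu
    have hf0 := Q.val.ne_zero_iff.2 ht0.1
    have hg0 := Q.val.ne_zero_iff.2 ht0.2
    rw [h1, hu, zero_pow_eq] at hf0
    rw [h2, hu, zero_pow_eq] at hg0
    simp only [ne_eq, ite_eq_right_iff, one_ne_zero, imp_false, not_not] at hf0 hg0
    rw [map_div₀, h1, h2, hf0, hg0, pow_zero, div_one, eq_comm,
      WithZero.exp_eq_one] at ht
    omega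
  rw [map_div₀, h1, h2] at ht
  have hl := congrArg WithZero.log ht
  rw [WithZero.log_div (pow_ne_zero _ hu) (pow_ne_zero _ hu), WithZero.log_pow, WithZero.log_pow,
    WithZero.log_exp, nsmul_eq_mul, nsmul_eq_mul, ← sub_mul] at hl
  have hneg : WithZero.log (Q.val u) < 0 := by
    rw [WithZero.log_lt_iff_lt_exp hu]; simpa using hu1
  have : WithZero.log (Q.val u) = -1 := by
    rcases Int.isUnit_iff.1 (isUnit_of_dvd_one (a := WithZero.log (Q.val u))
      ((dvd_neg (α := ℤ)).1 ⟨(n - m : ℤ), by rw [← hl]; ring⟩)) with h | h <;> omega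
  rw [← WithZero.exp_log hu, this]

/-- At an affine place, a unit of the valuation ring is a quotient of units of the coordinate
ring. -/
lemma IsAffineAt.exists_unit_div (hq : IsPrimePow q) [Fintype k] (hk : Fintype.card k = q ^ 2)
    (h : HermitianCoords k q x y) (hd : 0 < d) {Q : Place k F}
    (hQ : Q.IsAffineAt x y (q ^ (2 * d))) {z : F} (hz : Q.val z = 1) :
    ∃ f ∈ Algebra.adjoin k {x, y}, ∃ g ∈ Algebra.adjoin k {x, y},
      Q.val f = 1 ∧ Q.val g = 1 ∧ z = f / g := by
  have hz0 : z ≠ 0 := by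
    rw [← Q.val.ne_zero_iff, hz]; exact one_ne_zero
  obtain ⟨f, hf, g, hg, rfl⟩ := h.exists_div z
  rw [div_ne_zero_iff] at hz0
  obtain ⟨n, s, hs, f', hf', vs, vf, e1⟩ := hQ.exists_factor hq hk h.eqn hd hf hz0.1
  obtain ⟨m, s', hs', g', hg', vs', vg, e2⟩ := hQ.exists_factor hq hk h.eqn hd hg hz0.2
  have hu := hQ.val_eq hq hk h hd
  set u := x - x ^ q ^ (2 * d)
  have h1 : Q.val f = Q.val u ^ n := by
    simpa [vs, vf] using congrArg Q.val e1
  have h2 : Q.val g = Q.val u ^ m := by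
    simpa [vs', vg] using congrArg Q.val e2
  have ne : ∀ {a : F}, Q.val a = 1 → a ≠ 0 := fun {a} ha => by
    rw [← Q.val.ne_zero_iff, ha]; exact one_ne_zero
  have hnm : n = m := by
    rw [map_div₀, h1, h2, hu, ← WithZero.exp_nsmul, ← WithZero.exp_nsmul, ← WithZero.exp_sub,
      WithZero.exp_eq_one] at hz
    simp at hz
    omega
  subst hnm
  refine ⟨s' * f', mul_mem hs' hf', s * g', mul_mem hs hg', by simp [vs', vf], by simp [vs, vg], ?_⟩
  rw [div_eq_div_iff hz0.2 (mul_ne_zero (ne vs) (ne vg))]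
  have hu0 : u ^ n ≠ 0 := pow_ne_zero _ (by
    rw [← Q.val.ne_zero_iff, hu]; exact WithZero.exp_ne_zero)
  apply mul_left_cancel₀ hu0
  linear_combination s' * g * e1 - f * s * e2

/-- Two affine places with the same center on the affine curve are equal. -/
lemma IsAffineAt.eq_of_center_eq (hq : IsPrimePow q) [Fintype k] (hk : Fintype.card k = q ^ 2)
    (h : HermitianCoords k q x y) (hd : 0 < d) {P Q : Place k F}
    (hP : P.IsAffineAt x y (q ^ (2 * d))) (hx : Q.val x ≤ 1) (hy : Q.val y ≤ 1)
    (hc : ∀ f ∈ Algebra.adjoin k {x, y}, P.val f < 1 ↔ Q.val f < 1) : P = Q := by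
  have mx : x ∈ Algebra.adjoin k {x, y} := Algebra.subset_adjoin (by simp)
  have my : y ∈ Algebra.adjoin k {x, y} := Algebra.subset_adjoin (by simp)
  have hQ : Q.IsAffineAt x y (q ^ (2 * d)) :=
    ⟨hx, hy, (hc _ (sub_mem mx (pow_mem mx _))).1 hP.x_sub,
      (hc _ (sub_mem my (pow_mem my _))).1 hP.y_sub⟩
  have hc1 : ∀ f ∈ Algebra.adjoin k {x, y}, P.val f = 1 → Q.val f = 1 := by
    intro f hf h1
    have h2 := mt (hc f hf).2 (by simp [h1])
    exact le_antisymm (Q.val_le_one_of_mem_adjoin hx hy hf) (not_lt.1 h2)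
  -- A factorization of f taken at P serves at Q as well: units at P stay units at Q, and u has
  -- order one at both.
  have key : ∀ f ∈ Algebra.adjoin k {x, y}, P.val f = Q.val f := by
    intro f hf
    by_cases hf0 : f = 0
    · simp [hf0]
    obtain ⟨n, s, hs, g, hg, vs, vg, e⟩ := hP.exists_factor hq hk h.eqn hd hf hf0
    have h1 := congrArg P.val e
    have h2 := congrArg Q.val e
    simp only [map_mul, map_pow, vs, vg, one_mul, mul_one, hc1 s hs vs, hc1 g hg vg] at h1 h2
    rw [h1, h2]
    have := hP.val_eq hq hk h hd
    have := hQ.val_eq hq hk h hd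
    simp_all
  ext z
  obtain ⟨f, hf, g, hg, rfl⟩ := h.exists_div z
  rw [map_div₀, map_div₀, key f hf, key g hg]

/-- An affine place with rational center has degree one. -/
lemma degree_eq_one_of_val_sub_lt (hq : IsPrimePow q) [Fintype k] (hk : Fintype.card k = q ^ 2)
    (h : HermitianCoords k q x y) {Q : Place k F} {a b : k}
    (ha : Q.val (x - algebraMap k F a) < 1) (hb : Q.val (y - algebraMap k F b) < 1) :
    Q.degree = 1 := by
  have hle : ∀ {z : F} {c : k}, Q.val (z - algebraMap k F c) < 1 → Q.val z ≤ 1 := by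
    intro z c hz
    simpa using Q.val.map_add_le hz.le (Q.val_algebraMap_le c)
  have hmul : ∀ {z w : F} {c d : k}, Q.val (z - algebraMap k F c) < 1 →
      Q.val (w - algebraMap k F d) < 1 → Q.val (z * w - algebraMap k F (c * d)) < 1 := by
    intro z w c d hz hw
    have : z * w - algebraMap k F (c * d) =
        (z - algebraMap k F c) * w + algebraMap k F c * (w - algebraMap k F d) := by
      rw [map_mul]; ring
    rw [this]
    refine Q.val.map_add_lt ?_ ?_ <;> rw [map_mul]
    · exact mul_lt_one_of_nonneg_of_lt_one_left zero_le hz (hle hw)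
    · exact mul_lt_one_of_nonneg_of_lt_one_right (Q.val_algebraMap_le c) zero_le hw
  have key : ∀ f ∈ Algebra.adjoin k {x, y}, ∃ c : k, Q.val (f - algebraMap k F c) < 1 := by
    intro f hf
    induction hf using Algebra.adjoin_induction with
    | mem z hz => rcases hz with rfl | rfl; exacts [⟨a, ha⟩, ⟨b, hb⟩]
    | algebraMap c => exact ⟨c, by simp⟩
    | add f g _ _ h1 h2 =>
      obtain ⟨c, hc⟩ := h1
      obtain ⟨d, hd⟩ := h2
      exact ⟨c + d, by rw [map_add, add_sub_add_comm]; exact Q.val.map_add_lt hc hd⟩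
    | mul f g _ _ h1 h2 =>
      obtain ⟨c, hc⟩ := h1
      obtain ⟨d, hd⟩ := h2
      exact ⟨c * d, hmul hc hd⟩
  have hpow : ∀ {z : F} {c : k}, Q.val (z - algebraMap k F c) < 1 →
      Q.val (z - z ^ q ^ (2 * 1)) < 1 := by
    intro z c hz
    obtain ⟨φ, hφ⟩ := exists_ringHom_pow hq hk F (2 * 1)
    have e : z - z ^ q ^ (2 * 1) =
        (z - algebraMap k F c) - (z - algebraMap k F c) ^ q ^ (2 * 1) := by
      rw [← hφ (z - algebraMap k F c), map_sub, hφ, hφ, algebraMap_pow_card_pow hk]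
      ring
    rw [e]
    refine Q.val.map_sub_lt hz ?_
    rw [map_pow]
    exact pow_lt_one₀ zero_le hz (pow_ne_zero _ hq.pos.ne')
  have hQ : Q.IsAffineAt x y (q ^ (2 * 1)) := ⟨hle ha, hle hb, hpow ha, hpow hb⟩
  refine Q.degree_eq_one fun z hz => ?_
  rcases hz.lt_or_eq with hz | hz
  · exact ⟨0, by simpa using hz⟩
  -- Writing a unit with numerator and denominator that are both units at Q reduces rationality of
  -- its residue to that of polynomials in x and y.
  obtain ⟨f, hf, g, hg, vf, vg, rfl⟩ := hQ.exists_unit_div hq hk h one_pos hz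
  obtain ⟨c, hc⟩ := key f hf
  obtain ⟨d, hd⟩ := key g hg
  have hg0 : g ≠ 0 := by
    rw [← Q.val.ne_zero_iff, vg]; exact one_ne_zero
  have hd0 : d ≠ 0 := by
    rintro rfl
    simp [vg] at hd
  refine ⟨c / d, ?_⟩
  have hD : algebraMap k F d ≠ 0 := by simpa using hd0
  have e : f / g - algebraMap k F (c / d) = ((f - algebraMap k F c) * algebraMap k F d -
      algebraMap k F c * (g - algebraMap k F d)) / (g * algebraMap k F d) := by
    rw [map_div₀]
    field_simp
    ring
  rw [e, map_div₀, map_mul, vg, Q.trivial d hd0, one_mul, div_one]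
  refine Q.val.map_sub_lt ?_ ?_ <;> rw [map_mul]
  · exact mul_lt_one_of_nonneg_of_lt_one_left zero_le hc (Q.val_algebraMap_le d)
  · exact mul_lt_one_of_nonneg_of_lt_one_right (Q.val_algebraMap_le c) zero_le hd

end Local

end Place

/-! ### The places at the origin and at infinity. -/

namespace Place

variable {q : ℕ} {k F : Type*} [Field k] [Field F] [Algebra k F] {x y : F}

lemma val_pow_lt_self {Q : Place k F} {z : F} (hz : Q.val z < 1) (hz0 : z ≠ 0) {n : ℕ}
    (hn : 1 < n) : Q.val (z ^ n) < Q.val z := by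
  rw [map_pow]
  exact pow_lt_self_of_lt_one₀ (Q.val.pos_iff.2 hz0) hz hn

lemma val_pow_add_self {Q : Place k F} {z : F} (hz : Q.val z < 1) {n : ℕ}
    (hn : 1 < n) : Q.val (z ^ n + z) = Q.val z := by
  by_cases hz0 : z = 0
  · simp [hz0, Nat.ne_zero_of_lt hn]
  · exact Q.val.map_add_eq_of_lt_right (val_pow_lt_self hz hz0 hn)

lemma val_sub_pow_self {Q : Place k F} {z : F} (hz : Q.val z < 1) {n : ℕ}
    (hn : 1 < n) : Q.val (z - z ^ n) = Q.val z := by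
  by_cases hz0 : z = 0
  · simp [hz0, Nat.ne_zero_of_lt hn]
  · exact Q.val.map_sub_eq_of_lt_left (val_pow_lt_self hz hz0 hn)

/-- No degree is assumed: vanishing of x and y already makes their residues, being 0, fixed by the
Frobenius. -/
lemma isAffineAt_of_val_lt (hq : IsPrimePow q) {Q : Place k F} (hx : Q.val x < 1)
    (hy : Q.val y < 1) : Q.IsAffineAt x y (q ^ (2 * 1)) := by
  have : 1 < q ^ (2 * 1) := Nat.one_lt_pow (by omega) hq.one_lt
  exact ⟨hx.le, hy.le, by rwa [val_sub_pow_self hx this], by rwa [val_sub_pow_self hy this]⟩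

/-- At the origin, `x` is a uniformizer and `y` has order `q + 1`. -/
lemma val_of_origin (hq : IsPrimePow q) [Fintype k] (hk : Fintype.card k = q ^ 2)
    (h : HermitianCoords k q x y) {Q : Place k F} (hx : Q.val x < 1) (hy : Q.val y < 1) :
    Q.val x = WithZero.exp (-1) ∧ Q.val y = WithZero.exp (-((q : ℤ) + 1)) := by
  have h1 := (isAffineAt_of_val_lt hq hx hy).val_eq hq hk h one_pos
  rw [val_sub_pow_self hx (Nat.one_lt_pow (by omega) hq.one_lt)] at h1
  refine ⟨h1, ?_⟩
  -- At the origin y^q is negligible against y, so y has the order of x^(q+1).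
  rw [← val_pow_add_self hy hq.one_lt, ← h.eqn, map_pow, h1, ← WithZero.exp_nsmul]
  congr 1
  simp

/-- In x^(q+1) = y^q + y a pole of x forces one of y, and comparing pole orders gives x a smaller
pole than y. Thus the place is the origin for the coordinates supplied by `HermitianCoords.inv`. -/
lemma val_eq_of_not_regular (hq : IsPrimePow q) (h : HermitianCoords k q x y) {Q : Place k F}
    (hQ : ¬ (Q.val x ≤ 1 ∧ Q.val y ≤ 1)) : Q.val (x / y) < 1 ∧ Q.val (1 / y) < 1 := by
  have hq2 := hq.two_le
  have hy : 1 < Q.val y := by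
    by_contra hy
    rw [not_lt] at hy
    refine hQ ⟨?_, hy⟩
    by_contra hx
    rw [not_le] at hx
    have h1 : Q.val x ^ (q + 1) ≤ 1 := by
      rw [← map_pow, h.eqn]
      exact Q.val.map_add_le (by rw [map_pow]; exact pow_le_one₀ zero_le hy) hy
    exact absurd (one_lt_pow₀ hx (by omega)) (not_lt.2 h1)
  have hy0 : 0 < Q.val y := zero_lt_one.trans hy
  have hy' : Q.val (1 / y) < 1 := by
    rw [map_div₀, map_one]
    exact (div_lt_one₀ hy0).2 hy
  refine ⟨?_, hy'⟩
  rw [map_div₀, div_lt_one₀ hy0]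
  by_contra hxy
  rw [not_lt] at hxy
  have h1 : Q.val (y ^ q + y) ≤ Q.val y ^ q :=
    Q.val.map_add_le (map_pow _ _ _).le (le_self_pow₀ hy.le (by omega))
  rw [← h.eqn, map_pow] at h1
  have h2 : Q.val y ^ (q + 1) ≤ Q.val y ^ q := (pow_le_pow_left₀ zero_le hxy _).trans h1
  exact absurd (pow_lt_pow_right₀ hy (Nat.lt_succ_self q)) (not_lt.2 h2)

/-- There is at most one place centered at the origin. -/
lemma eq_of_origin (hq : IsPrimePow q) [Fintype k] (hk : Fintype.card k = q ^ 2)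
    (h : HermitianCoords k q x y) {P Q : Place k F} (hPx : P.val x < 1) (hPy : P.val y < 1)
    (hQx : Q.val x < 1) (hQy : Q.val y < 1) : P = Q := by
  refine (isAffineAt_of_val_lt hq hPx hPy).eq_of_center_eq hq hk h one_pos hQx.le hQy.le ?_
  intro f hf
  have hmul : ∀ {R : Place k F}, R.val x < 1 → R.val y < 1 → ∀ {f g : F} {c d : k},
      f ∈ Algebra.adjoin k {x, y} → R.val (f - algebraMap k F c) < 1 →
      R.val (g - algebraMap k F d) < 1 → R.val (f * g - algebraMap k F (c * d)) < 1 := by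
    intro R hx hy f g c d hf h1 h2
    have e : f * g - algebraMap k F (c * d) =
        f * (g - algebraMap k F d) + algebraMap k F d * (f - algebraMap k F c) := by
      rw [map_mul]; ring
    rw [e]
    refine R.val.map_add_lt ?_ ?_ <;> rw [map_mul]
    · exact mul_lt_one_of_nonneg_of_lt_one_right (R.val_le_one_of_mem_adjoin hx.le hy.le hf)
        zero_le h2
    · exact mul_lt_one_of_nonneg_of_lt_one_right (R.val_algebraMap_le d) zero_le h1
  -- Every polynomial in x and y takes its constant term as value at both places.
  have key : ∃ c : k, P.val (f - algebraMap k F c) < 1 ∧ Q.val (f - algebraMap k F c) < 1 := by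
    induction hf using Algebra.adjoin_induction with
    | mem z hz =>
      rcases hz with rfl | rfl
      exacts [⟨0, by simpa using hPx, by simpa using hQx⟩,
        ⟨0, by simpa using hPy, by simpa using hQy⟩]
    | algebraMap c => exact ⟨c, by simp⟩
    | add f g _ _ h1 h2 =>
      obtain ⟨c, hc, hc'⟩ := h1
      obtain ⟨d, hd, hd'⟩ := h2
      refine ⟨c + d, ?_, ?_⟩ <;> rw [map_add, add_sub_add_comm]
      exacts [P.val.map_add_lt hc hd, Q.val.map_add_lt hc' hd']
    | mul f g hf _ h1 h2 =>
      obtain ⟨c, hc, hc'⟩ := h1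
      obtain ⟨d, hd, hd'⟩ := h2
      exact ⟨c * d, hmul hPx hPy hf hc hd, hmul hQx hQy hf hc' hd'⟩
  obtain ⟨c, hc, hc'⟩ := key
  have hiff : ∀ {R : Place k F}, R.val (f - algebraMap k F c) < 1 → (R.val f < 1 ↔ c = 0) := by
    intro R hR
    refine ⟨fun h1 => ?_, fun h1 => by simpa [h1] using hR⟩
    rw [← R.val_algebraMap_lt_one_iff]
    simpa using R.val.map_sub_lt h1 hR
  rw [hiff hc, hiff hc']

/-- Every place of degree one is the place at infinity in suitable coordinates. -/
lemma exists_coords_at_infinity (hq : IsPrimePow q) [Fintype k] (hk : Fintype.card k = q ^ 2)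
    (h : HermitianCoords k q x y) {Q : Place k F} (hQ : Q.degree = 1) :
    ∃ x y : F, HermitianCoords k q x y ∧ y ≠ 0 ∧ Q.val (x / y) < 1 ∧ Q.val (1 / y) < 1 := by
  by_cases hreg : Q.val x ≤ 1 ∧ Q.val y ≤ 1
  swap
  · refine ⟨x, y, h, ?_, val_eq_of_not_regular hq h hreg⟩
    rintro rfl
    refine hreg ⟨?_, by simp⟩
    have := h.eqn
    rw [zero_pow hq.pos.ne', add_zero] at this
    simp [eq_zero_of_pow_eq_zero this]
  obtain ⟨a, ha⟩ := exists_val_sub_lt hQ hreg.1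
  obtain ⟨b, hb⟩ := exists_val_sub_lt hQ hreg.2
  obtain ⟨φ, hφ⟩ := exists_ringHom_pow hq hk F 1
  simp only [pow_one] at hφ
  have hq0 := hq.pos.ne'
  have hbq : Q.val (y ^ q - algebraMap k F b ^ q) < 1 := by
    rw [← hφ, ← hφ, ← map_sub, hφ, map_pow]
    exact pow_lt_one₀ zero_le hb hq0
  have haq : Q.val (x ^ q - algebraMap k F a ^ q) < 1 := by
    rw [← hφ, ← hφ, ← map_sub, hφ, map_pow]
    exact pow_lt_one₀ zero_le ha hq0
  have haA : Q.val (algebraMap k F a ^ q * (x - algebraMap k F a)) < 1 := by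
    rw [map_mul, ← map_pow (algebraMap k F)]
    exact mul_lt_one_of_nonneg_of_lt_one_right (Q.val_algebraMap_le _) zero_le ha
  -- Reducing the curve equation at Q shows that the constant (a, b) lies on the curve.
  have hab : a ^ (q + 1) = b ^ q + b := by
    rw [← sub_eq_zero, ← Q.val_algebraMap_lt_one_iff]
    have e : algebraMap k F (a ^ (q + 1) - (b ^ q + b)) =
        (y ^ q - algebraMap k F b ^ q) + (y - algebraMap k F b) -
        (x * (x ^ q - algebraMap k F a ^ q) +
          algebraMap k F a ^ q * (x - algebraMap k F a)) := by
      have := h.eqn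
      simp only [map_sub, map_add, map_pow]
      linear_combination this
    rw [e]
    refine Q.val.map_sub_lt (Q.val.map_add_lt hbq hb) (Q.val.map_add_lt ?_ haA)
    rw [map_mul]
    exact mul_lt_one_of_nonneg_of_lt_one_right hreg.1 zero_le haq
  -- Translation moves Q to the origin; inversion then carries the origin to infinity.
  have ht := h.translate hq hk hab
  have hy : Q.val (y + algebraMap k F b ^ q - algebraMap k F a ^ q * x) < 1 := by
    have e : y + algebraMap k F b ^ q - algebraMap k F a ^ q * x =
        (y - algebraMap k F b) - algebraMap k F a ^ q * (x - algebraMap k F a) := by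
      have := congrArg (algebraMap k F) hab
      simp only [map_add, map_pow] at this
      linear_combination -this
    rw [e]
    exact Q.val.map_sub_lt hb haA
  have hy0 : y + algebraMap k F b ^ q - algebraMap k F a ^ q * x ≠ 0 := by
    rw [← Q.val.ne_zero_iff, (val_of_origin hq hk ht ha hy).2]
    exact WithZero.exp_ne_zero
  refine ⟨_, _, ht.inv hy0, by simpa using hy0, ?_, ?_⟩
  · simpa [hy0] using ha
  · simpa [hy0] using hy

end Place

/-! ### Coordinates on the concrete function field. -/

namespace Hermitian

/-- The function field of the Hermitian curve is generated by its two coordinate functions. -/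
lemma exists_coords (q : ℕ) [hq : Fact (IsPrimePow q)] (k : Type*) [Field k] :
    ∃ x y : FunctionField q k, HermitianCoords k q x y := by
  let x : FunctionField q k := algebraMap (CoordinateRing q k) _ (AdjoinRoot.root _)
  let y : FunctionField q k :=
    algebraMap (CoordinateRing q k) _ (AdjoinRoot.of (equation q k) Polynomial.X)
  have hX : x ∈ Algebra.adjoin k {x, y} := Algebra.subset_adjoin (by simp)
  have hY : y ∈ Algebra.adjoin k {x, y} := Algebra.subset_adjoin (by simp)
  refine ⟨x, y, ?_, ?_⟩
  · have heval : ∀ {S : Type _} [CommRing S] (φ : k[X] →+* S) (r : S), (equation q k).eval₂ φ r =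
        r ^ (q + 1) - (φ Polynomial.X ^ q + φ Polynomial.X) := by
      intro S _ φ r
      rw [equation, Polynomial.eval₂_sub, Polynomial.eval₂_X_pow, Polynomial.eval₂_C, map_add,
        map_pow]
    have h := AdjoinRoot.eval₂_root (equation q k)
    rw [heval, sub_eq_zero] at h
    have h' := congrArg (algebraMap (CoordinateRing q k) (FunctionField q k)) h
    simpa only [map_add, map_pow] using h'
  · have hof : ∀ p : k[X], algebraMap (CoordinateRing q k) (FunctionField q k)
        (AdjoinRoot.of (equation q k) p) ∈ Algebra.adjoin k {x, y} := by
      intro p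
      induction p using Polynomial.induction_on' with
      | add p r hp hr => rw [map_add, map_add]; exact add_mem hp hr
      | monomial n a =>
        rw [← Polynomial.C_mul_X_pow_eq_monomial, map_mul, map_mul, map_pow, map_pow]
        exact mul_mem (Subalgebra.algebraMap_mem (Algebra.adjoin k {x, y}) a) (pow_mem hY n)
    have hmem : ∀ z : CoordinateRing q k, algebraMap (CoordinateRing q k) (FunctionField q k) z ∈
        Algebra.adjoin k {x, y} := by
      intro z
      induction z using AdjoinRoot.induction_on with
      | ih p =>
        induction p using Polynomial.induction_on' with
        | add p r hp hr => rw [map_add, map_add]; exact add_mem hp hr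
        | monomial n a =>
          rw [← Polynomial.C_mul_X_pow_eq_monomial, map_mul, map_mul, map_pow, map_pow]
          exact mul_mem (hof a) (pow_mem hX n)
    refine top_unique fun z _ => ?_
    obtain ⟨f, g, -, rfl⟩ := IsFractionRing.div_surjective (A := CoordinateRing q k) z
    exact IntermediateField.mem_adjoin_iff_div.2 ⟨_, hmem f, _, hmem g, rfl⟩

end Hermitian

/-! ### Cubic forms, products of three lines, and descent to k. -/

section CubicForm

variable {R S : Type*} [CommRing R] [CommRing S]

/-- The ternary cubic form with coefficient `1` at `y ^ 3` and the given other coefficients. -/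
def cubicForm (c : Fin 9 → R) (x y z : R) : R :=
  y ^ 3 + c 0 * y ^ 2 * z + c 1 * y ^ 2 * x + c 2 * y * z ^ 2 + c 3 * y * x ^ 2 +
    c 4 * y * x * z + c 5 * z ^ 3 + c 6 * z ^ 2 * x + c 7 * z * x ^ 2 + c 8 * x ^ 3

/-- The coefficients of the product of the three linear forms `y + B i * z - A i * x`. -/
def lineCoeffs (A B : Fin 3 → R) : Fin 9 → R :=
  ![B 0 + B 1 + B 2, -(A 0 + A 1 + A 2), B 0 * B 1 + B 0 * B 2 + B 1 * B 2,
    A 0 * A 1 + A 0 * A 2 + A 1 * A 2,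
    -(B 0 * A 1 + B 0 * A 2 + B 1 * A 0 + B 1 * A 2 + B 2 * A 0 + B 2 * A 1),
    B 0 * B 1 * B 2, -(B 0 * B 1 * A 2 + B 0 * A 1 * B 2 + A 0 * B 1 * B 2),
    B 0 * A 1 * A 2 + A 0 * B 1 * A 2 + A 0 * A 1 * B 2, -(A 0 * A 1 * A 2)]

lemma cubicForm_lineCoeffs (A B : Fin 3 → R) (x y z : R) :
    cubicForm (lineCoeffs A B) x y z =
      (y + B 0 * z - A 0 * x) * (y + B 1 * z - A 1 * x) * (y + B 2 * z - A 2 * x) := by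
  simp only [cubicForm, lineCoeffs, Matrix.cons_val]
  ring

lemma map_cubicForm (φ : R →+* S) (c : Fin 9 → R) (x y z : R) :
    φ (cubicForm c x y z) = cubicForm (fun j => φ (c j)) (φ x) (φ y) (φ z) := by
  simp [cubicForm]

lemma map_lineCoeffs (φ : R →+* S) (A B : Fin 3 → R) (j : Fin 9) :
    φ (lineCoeffs A B j) = lineCoeffs (fun i => φ (A i)) (fun i => φ (B i)) j := by
  fin_cases j <;> simp [lineCoeffs]

/-- Invariance under cyclic shifts is all that descent needs, since Frobenius shifts the three lines
cyclically. -/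
lemma lineCoeffs_rotate (A B : Fin 3 → R) :
    lineCoeffs (fun i => A (i + 1)) (fun i => B (i + 1)) = lineCoeffs A B := by
  funext j
  fin_cases j <;> simp [lineCoeffs] <;> ring

/-- Homogeneity, used with x' = x/y and y' = 1/y to pass to the chart at infinity, where the
coefficient 1 of y³ makes the form a unit. -/
lemma cubicForm_eq_mul (c : Fin 9 → R) {x y x' y' : R} (hx : x = y * x') (hy : y * y' = 1) :
    cubicForm c x y 1 = y ^ 3 * cubicForm c x' 1 y' := by
  subst hx
  simp only [cubicForm]
  linear_combination (-c 0 * y ^ 2 - c 2 * y * (1 + y * y') - c 5 * (1 + y * y' + y ^ 2 * y' ^ 2)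
    - c 4 * y ^ 2 * x' - c 6 * y * x' * (1 + y * y') - c 7 * y ^ 2 * x' ^ 2) * hy

end CubicForm

section Descent

variable {q : ℕ} {k : Type*} [Field k] [Fintype k]

/-- The product of three linear forms permuted cyclically by Frobenius has coefficients in `k`. -/
lemma exists_cubicForm_coeffs (hq : IsPrimePow q) (hk : Fintype.card k = q ^ 2) {K : Type*}
    [Field K] [Algebra k K] (hK : ∀ z : K, z ^ q ^ (2 * 3) = z) (a b : K) :
    ∃ c : Fin 9 → k, ∀ j, algebraMap k K (c j) = lineCoeffs (fun i : Fin 3 => a ^ q ^ (2 * i.1 + 1))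
      (fun i : Fin 3 => b ^ q ^ (2 * i.1 + 1)) j := by
  obtain ⟨φ, hφ⟩ := exists_ringHom_pow hq hk K 2
  have key : ∀ j, ∃ c : k, algebraMap k K c = lineCoeffs (fun i : Fin 3 => a ^ q ^ (2 * i.1 + 1))
      (fun i : Fin 3 => b ^ q ^ (2 * i.1 + 1)) j := by
    intro j
    apply exists_algebraMap_of_pow_card
    -- The tangent at the conjugate (a^(q^(2i)), b^(q^(2i))) has the q-th powers of these as
    -- coefficients, hence the exponents 2i + 1; the q²-power map raises i by one.
    have rot : ∀ (z : K) (i : Fin 3),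
        φ (z ^ q ^ (2 * i.1 + 1)) = z ^ q ^ (2 * (i + 1).1 + 1) := by
      intro z i
      rw [hφ, ← pow_mul, ← pow_add]
      fin_cases i
      · rfl
      · rfl
      -- The index wraps around because z^(q^6) = z.
      · change z ^ q ^ (2 * 3 + 1) = z ^ q ^ (2 * 0 + 1)
        rw [pow_succ, pow_mul, hK]
        simp
    rw [hk, ← hφ, map_lineCoeffs]
    simp only [rot]
    exact congrFun (lineCoeffs_rotate (fun i : Fin 3 => a ^ q ^ (2 * i.1 + 1))
      (fun i : Fin 3 => b ^ q ^ (2 * i.1 + 1))) j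
  choose c hc using key
  exact ⟨c, hc⟩

end Descent

/-! ### Tangent lines: poles and zeros of the cubic away from P. -/

/-- The tangent line at a point of the Hermitian curve meets it only in the point itself and in
its Frobenius conjugate. -/
lemma tangent_identity {R : Type*} [CommRing R] {q : ℕ} {φ : R →+* R} (hφ : ∀ z, φ z = z ^ q)
    {x y a b : R} (e : x ^ (q + 1) = y ^ q + y) (e' : a ^ (q + 1) = b ^ q + b) :
    (y + b ^ q - a ^ q * x) ^ q + (y + b ^ q - a ^ q * x) =
      (x - a) ^ q * (x - (a ^ q) ^ q) := by
  -- The equation of the point (a, b), raised to the q-th power.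
  have e2 : (a ^ q) ^ q * a ^ q = (b ^ q) ^ q + b ^ q := by
    rw [← pow_succ, ← pow_mul, mul_comm, pow_mul, e', ← hφ, map_add, hφ, hφ]
  rw [← hφ (y + b ^ q - a ^ q * x), ← hφ (x - a), map_sub, map_sub, map_add, map_mul]
  simp only [hφ]
  rw [pow_succ] at e
  linear_combination -e2 - e

namespace Place

variable {q : ℕ} {k F : Type*} [Field k] [Field F] [Algebra k F] {x y : F}

lemma coe_cubicForm (Q : Place k F) (c : Fin 9 → k) (X Y Z : Q.integers) :
    ((cubicForm (fun j => algebraMap k Q.integers (c j)) X Y Z : Q.integers) : F) =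
      cubicForm (fun j => algebraMap k F (c j)) X Y Z := by
  have := map_cubicForm Q.integers.subtype (fun j => algebraMap k Q.integers (c j)) X Y Z
  exact this

lemma val_eq_one_of_not_lt {Q : Place k F} (z : Q.integers) (h : ¬ Q.val z < 1) : Q.val z = 1 :=
  le_antisymm z.2 (not_lt.1 h)

/-- The function given by a cubic form has a pole of order `3 (q + 1)` at infinity. -/
lemma val_cubicForm_infinity {Q : Place k F} (hy : y ≠ 0)
    (hQx : Q.val (x / y) < 1) (hQy : Q.val (1 / y) < 1) (c : Fin 9 → k) :
    Q.val (cubicForm (fun j => algebraMap k F (c j)) x y 1) = Q.val y ^ 3 := by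
  rw [cubicForm_eq_mul _ (x' := x / y) (y' := 1 / y) (by field_simp) (by field_simp), map_mul,
    map_pow]
  convert mul_one _
  let X : Q.integers := ⟨x / y, hQx.le⟩
  let Y : Q.integers := ⟨1 / y, hQy.le⟩
  have hG : ((cubicForm (fun j => algebraMap k Q.integers (c j)) X 1 Y : Q.integers) : F) =
      cubicForm (fun j => algebraMap k F (c j)) (x / y) 1 (1 / y) := Q.coe_cubicForm c X 1 Y
  have hX : IsLocalRing.residue Q.integers X = 0 := (Q.residue_eq_zero_iff X).2 hQx
  have hY : IsLocalRing.residue Q.integers Y = 0 := (Q.residue_eq_zero_iff Y).2 hQy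
  rw [← hG]
  refine val_eq_one_of_not_lt _ fun h => ?_
  rw [← Q.residue_eq_zero_iff, map_cubicForm, hX, hY, map_one] at h
  simp [cubicForm] at h

/-- Places whose coordinates have the same images in a field have the same center. -/
lemma val_lt_one_iff_of_hom_eq {Ω : Type*} [Field Ω] {P Q : Place k F}
    (σ : P.integers →+* Ω) (τ : Q.integers →+* Ω)
    (hσ : ∀ z, σ z = 0 ↔ P.val z < 1) (hτ : ∀ z, τ z = 0 ↔ Q.val z < 1)
    (hk : ∀ c : k, σ (algebraMap k P.integers c) = τ (algebraMap k Q.integers c))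
    (hPx : P.val x ≤ 1) (hPy : P.val y ≤ 1) (hQx : Q.val x ≤ 1) (hQy : Q.val y ≤ 1)
    (hx : σ ⟨x, hPx⟩ = τ ⟨x, hQx⟩) (hy : σ ⟨y, hPy⟩ = τ ⟨y, hQy⟩)
    {f : F} (hf : f ∈ Algebra.adjoin k {x, y}) : P.val f < 1 ↔ Q.val f < 1 := by
  have key : ∃ (h : P.val f ≤ 1) (h' : Q.val f ≤ 1), σ ⟨f, h⟩ = τ ⟨f, h'⟩ := by
    induction hf using Algebra.adjoin_induction with
    | mem z hz =>
      rcases hz with rfl | rfl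
      exacts [⟨hPx, hQx, hx⟩, ⟨hPy, hQy, hy⟩]
    | algebraMap c => exact ⟨P.val_algebraMap_le c, Q.val_algebraMap_le c, hk c⟩
    | add f g _ _ h1 h2 =>
      obtain ⟨h, h', e⟩ := h1
      obtain ⟨j, j', e'⟩ := h2
      refine ⟨P.val.map_add_le h j, Q.val.map_add_le h' j', ?_⟩
      have := congrArg₂ (· + ·) e e'
      simp only [← map_add] at this
      exact this
    | mul f g _ _ h1 h2 =>
      obtain ⟨h, h', e⟩ := h1
      obtain ⟨j, j', e'⟩ := h2
      refine ⟨by rw [map_mul]; exact mul_le_one' h j, by rw [map_mul]; exact mul_le_one' h' j', ?_⟩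
      have := congrArg₂ (· * ·) e e'
      simp only [← map_mul] at this
      exact this
  obtain ⟨h, h', e⟩ := key
  rw [← hσ ⟨f, h⟩, ← hτ ⟨f, h'⟩, e]

/-- The product of the tangent lines at the conjugates of `P` vanishes at no other affine place. -/
lemma val_cubicForm_eq_one [Fintype k] (hq : IsPrimePow q) (hk : Fintype.card k = q ^ 2)
    (h : HermitianCoords k q x y) {P Q : Place k F} (hP : P.degree = 3) (hPx : P.val x ≤ 1)
    (hPy : P.val y ≤ 1) (hQx : Q.val x ≤ 1) (hQy : Q.val y ≤ 1) (hPQ : P ≠ Q) {c : Fin 9 → k}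
    (hc : ∀ j, algebraMap k P.residueField (c j) =
      lineCoeffs (fun i : Fin 3 => IsLocalRing.residue P.integers ⟨x, hPx⟩ ^ q ^ (2 * i.1 + 1))
        (fun i : Fin 3 => IsLocalRing.residue P.integers ⟨y, hPy⟩ ^ q ^ (2 * i.1 + 1)) j) :
    Q.val (cubicForm (fun j => algebraMap k F (c j)) x y 1) = 1 := by
  have : Module.Finite k P.residueField := Module.finite_of_finrank_pos (by
    rw [degree] at hP; omega)
  -- Q may have any degree. The residue field of P is finite over k and so embeds in Ω, where the
  -- centers of P and Q can be compared.
  let Ω := AlgebraicClosure Q.residueField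
  let ι : P.residueField →ₐ[k] Ω := IsAlgClosed.lift
  let τ : Q.integers →+* Ω := (algebraMap Q.residueField Ω).comp (IsLocalRing.residue Q.integers)
  let X : Q.integers := ⟨x, hQx⟩
  let Y : Q.integers := ⟨y, hQy⟩
  have hτ : ∀ z, τ z = 0 ↔ Q.val z < 1 := fun z => by
    rw [← Q.residue_eq_zero_iff]
    exact map_eq_zero (algebraMap Q.residueField Ω)
  have hτk : ∀ c : k, τ (algebraMap k Q.integers c) = algebraMap k Ω c := fun c =>
    (IsScalarTower.algebraMap_apply k Q.residueField Ω c).symm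
  have hG : ((cubicForm (fun j => algebraMap k Q.integers (c j)) X Y 1 : Q.integers) : F) =
      cubicForm (fun j => algebraMap k F (c j)) x y 1 := Q.coe_cubicForm c X Y 1
  rw [← hG]
  refine val_eq_one_of_not_lt _ fun hlt => hPQ ?_
  set a := IsLocalRing.residue P.integers ⟨x, hPx⟩ with ha
  set b := IsLocalRing.residue P.integers ⟨y, hPy⟩ with hb
  have eK : a ^ (q + 1) = b ^ q + b := by
    rw [ha, hb, ← map_pow, ← map_pow, ← map_add]
    exact congrArg _ (Subtype.ext h.eqn)
  have eQ : τ X ^ (q + 1) = τ Y ^ q + τ Y := by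
    rw [← map_pow, ← map_pow, ← map_add]
    exact congrArg _ (Subtype.ext h.eqn)
  rw [← hτ, map_cubicForm, map_one] at hlt
  have hcoef : (fun j => τ (algebraMap k Q.integers (c j))) =
      lineCoeffs (fun i : Fin 3 => ι a ^ q ^ (2 * i.1 + 1))
        (fun i : Fin 3 => ι b ^ q ^ (2 * i.1 + 1)) := by
    funext j
    rw [hτk, ← ι.commutes, hc j]
    have := map_lineCoeffs ι.toRingHom (fun i : Fin 3 => a ^ q ^ (2 * i.1 + 1))
      (fun i : Fin 3 => b ^ q ^ (2 * i.1 + 1)) j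
    simpa only [AlgHom.toRingHom_eq_coe, RingHom.coe_coe, map_pow] using this
  rw [hcoef, cubicForm_lineCoeffs] at hlt
  have hex : ∃ i : ℕ, τ Y + ι b ^ q ^ (2 * i + 1) - ι a ^ q ^ (2 * i + 1) * τ X = 0 := by
    simp only [mul_one] at hlt
    rcases mul_eq_zero.1 hlt with h1 | h1
    · rcases mul_eq_zero.1 h1 with h1 | h1
      exacts [⟨0, h1⟩, ⟨1, h1⟩]
    · exact ⟨2, h1⟩
  obtain ⟨φ, hφ⟩ := exists_ringHom_pow hq hk Ω 1
  simp only [pow_one] at hφ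
  -- Where the i-th tangent vanishes, the tangent identity leaves two abscissas, those of the i-th
  -- and (i+1)-st conjugates; the line then determines the ordinate. So the center of Q is conjugate
  -- to that of P.
  have hpt : ∃ j : ℕ, ι a ^ q ^ (2 * j) = τ X ∧ ι b ^ q ^ (2 * j) = τ Y := by
    obtain ⟨i, hi⟩ := hex
    obtain ⟨ψ, hψ⟩ := exists_ringHom_pow hq hk Ω (2 * i)
    have e1 : (ι a ^ q ^ (2 * i)) ^ (q + 1) = (ι b ^ q ^ (2 * i)) ^ q + ι b ^ q ^ (2 * i) := by
      rw [← pow_mul, mul_comm, pow_mul, ← map_pow, eK, ← hψ, map_add, map_add, hψ, hψ, map_pow,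
        ← pow_mul, ← pow_mul, mul_comm]
    have e2 := tangent_identity hφ eQ e1
    simp only [pow_succ q (2 * i), pow_mul _ (q ^ (2 * i)) q] at hi
    have hdouble : ∀ z : Ω, z ^ q ^ (2 * (i + 1)) = ((z ^ q ^ (2 * i)) ^ q) ^ q := fun z => by
      rw [← pow_mul, ← pow_mul, mul_add_one, pow_add, sq]
    set a' := ι a ^ q ^ (2 * i)
    set b' := ι b ^ q ^ (2 * i)
    rw [hi, zero_pow hq.pos.ne', add_zero, eq_comm, mul_eq_zero] at e2
    rcases e2 with e2 | e2
    · refine ⟨i, (sub_eq_zero.1 (eq_zero_of_pow_eq_zero e2)).symm, ?_⟩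
      have hx := sub_eq_zero.1 (eq_zero_of_pow_eq_zero e2)
      rw [hx] at hi
      rw [pow_succ] at e1
      linear_combination -e1 - hi
    · refine ⟨i + 1, ?_, ?_⟩ <;> rw [hdouble]
      · exact (sub_eq_zero.1 e2).symm
      · rw [sub_eq_zero.1 e2] at hi
        have e3 := congrArg φ e1
        rw [map_add, hφ, hφ, hφ, ← pow_mul, mul_comm, pow_mul, pow_succ] at e3
        linear_combination -e3 - hi
  obtain ⟨j, hjx, hjy⟩ := hpt
  obtain ⟨ψ, hψ⟩ := exists_ringHom_pow hq hk Ω (2 * j)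
  refine (isAffineAt_of_degree hk (by norm_num) hP hPx hPy).eq_of_center_eq hq hk h (by norm_num)
    hQx hQy fun f hf => ?_
  -- Reduction at P followed by the q^(2j)-Frobenius agrees with reduction at Q on k, x and y.
  refine val_lt_one_iff_of_hom_eq (ψ.comp (ι.toRingHom.comp (IsLocalRing.residue P.integers))) τ
    ?_ hτ ?_ hPx hPy hQx hQy ?_ ?_ hf
  · intro z
    rw [← P.residue_eq_zero_iff]
    simp
  · intro c
    rw [hτk]
    change ψ (ι (algebraMap k P.residueField c)) = _
    rw [ι.commutes, hψ, algebraMap_pow_card_pow hk]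
  · change ψ (ι a) = τ X
    rw [hψ, hjx]
  · change ψ (ι b) = τ Y
    rw [hψ, hjy]

end Place

/-! ### The order of the cubic at P. -/

namespace Place

variable {q : ℕ} {k F : Type*} [Field k] [Field F] [Algebra k F] {x y : F}

/-- The fixed y³ terms cancel, leaving the coefficient differences multiplied by monomials regular
at Q. -/
lemma val_cubicForm_sub_le {Q : Place k F} (hx : Q.val x ≤ 1) (hy : Q.val y ≤ 1)
    {c c' : Fin 9 → F} {g : ℤᵐ⁰} (h : ∀ j, Q.val (c j - c' j) ≤ g) :
    Q.val (cubicForm c x y 1 - cubicForm c' x y 1) ≤ g := by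
  have hm : ∀ (j : Fin 9) (m n : ℕ), Q.val ((c j - c' j) * (y ^ m * x ^ n)) ≤ g := by
    intro j m n
    rw [map_mul, map_mul, map_pow, map_pow]
    exact (mul_le_of_le_one_right' (mul_le_one' (pow_le_one₀ zero_le hy)
      (pow_le_one₀ zero_le hx))).trans (h j)
  have e : cubicForm c x y 1 - cubicForm c' x y 1 =
      (c 0 - c' 0) * (y ^ 2 * x ^ 0) + (c 1 - c' 1) * (y ^ 2 * x ^ 1) +
      (c 2 - c' 2) * (y ^ 1 * x ^ 0) + (c 3 - c' 3) * (y ^ 1 * x ^ 2) +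
      (c 4 - c' 4) * (y ^ 1 * x ^ 1) + (c 5 - c' 5) * (y ^ 0 * x ^ 0) +
      (c 6 - c' 6) * (y ^ 0 * x ^ 1) + (c 7 - c' 7) * (y ^ 0 * x ^ 2) +
      (c 8 - c' 8) * (y ^ 0 * x ^ 3) := by
    simp only [cubicForm]
    ring
  rw [e]
  refine Q.val.map_add_le (Q.val.map_add_le (Q.val.map_add_le (Q.val.map_add_le (Q.val.map_add_le
    (Q.val.map_add_le (Q.val.map_add_le (Q.val.map_add_le ?_ ?_) ?_) ?_) ?_) ?_) ?_) ?_) ?_ <;>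
  exact hm _ _ _

section DegreeThree

variable {P : Place k F}

/-- The residue of `x` at a place of degree three is not rational. -/
lemma residue_pow_ne (hq : IsPrimePow q) [Fintype k] (hk : Fintype.card k = q ^ 2)
    (h : HermitianCoords k q x y) (hP : P.degree = 3) (hPx : P.val x ≤ 1)
    (hPy : P.val y ≤ 1) : IsLocalRing.residue P.integers ⟨x, hPx⟩ ^ q ^ 2 ≠
      IsLocalRing.residue P.integers ⟨x, hPx⟩ := by
  intro hx
  obtain ⟨φ, hφ⟩ := exists_ringHom_pow hq hk P.residueField 1
  simp only [pow_one] at hφ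
  have eK : IsLocalRing.residue P.integers ⟨x, hPx⟩ ^ (q + 1) =
      IsLocalRing.residue P.integers ⟨y, hPy⟩ ^ q + IsLocalRing.residue P.integers ⟨y, hPy⟩ := by
    rw [← map_pow, ← map_pow, ← map_add]
    exact congrArg _ (Subtype.ext h.eqn)
  have hval : ∀ {z : F} (hz : P.val z ≤ 1), IsLocalRing.residue P.integers ⟨z, hz⟩ ^ q ^ 2 =
      IsLocalRing.residue P.integers ⟨z, hz⟩ → ∃ c : k, P.val (z - algebraMap k F c) < 1 := by
    intro z hz hz'
    rw [← hk] at hz'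
    obtain ⟨c, hc⟩ := exists_algebraMap_of_pow_card hz'
    exact ⟨c, (P.hasValue_iff.1 ⟨hz, hc.symm⟩).2⟩
  obtain ⟨c, hc⟩ := hval hPx hx
  -- Subtracting the residue equation from its q-th power gives b^(q²) = b once a^(q²) = a.
  obtain ⟨d, hd⟩ := hval hPy (by
    have e := congrArg φ eK
    rw [map_add, hφ, hφ, hφ, ← pow_mul, mul_comm, pow_mul, pow_succ, ← pow_mul, ← pow_mul, ← sq,
      hx] at e
    rw [pow_succ] at eK
    linear_combination eK - e)
  have := degree_eq_one_of_val_sub_lt hq hk h hc hd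
  omega

/-- The function `y + y ^ (q ^ (n + 1)) - x ^ (q ^ (n + 1)) * x` approximates the tangent line at
a conjugate of `P`. -/
lemma tangent_pow_identity (hq : IsPrimePow q) [Fintype k] (hk : Fintype.card k = q ^ 2)
    (h : HermitianCoords k q x y) (n : ℕ) :
    (y + y ^ q ^ (n + 1) - x ^ q ^ (n + 1) * x) ^ q + (y + y ^ q ^ (n + 1) - x ^ q ^ (n + 1) * x) =
      (x - x ^ q ^ n) ^ q * (x - x ^ q ^ (n + 2)) := by
  obtain ⟨φ, hφ⟩ := exists_ringHom_pow hq hk F 1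
  obtain ⟨ψ, hψ⟩ := exists_ringHom_pow hq hk F n
  simp only [pow_one] at hφ
  -- The Frobenius image (x^(q^n), y^(q^n)) is itself a point of the curve over F, and the claim is
  -- the tangent identity there.
  have e : (x ^ q ^ n) ^ (q + 1) = (y ^ q ^ n) ^ q + y ^ q ^ n := by
    rw [← hψ, ← hψ, ← map_pow, ← map_pow, ← map_add, h.eqn]
  have := tangent_identity hφ h.eqn e
  simpa only [← pow_mul, ← pow_succ] using this

/-- If L vanishes at P, then L^q + L has the same order as L, and the product formula computes it.
-/
lemma val_tangent_of_lt (hq : IsPrimePow q) [Fintype k] (hk : Fintype.card k = q ^ 2)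
    (h : HermitianCoords k q x y) {n : ℕ}
    (hn : P.val (y + y ^ q ^ (n + 1) - x ^ q ^ (n + 1) * x) < 1) :
    P.val (y + y ^ q ^ (n + 1) - x ^ q ^ (n + 1) * x) =
      P.val (x - x ^ q ^ n) ^ q * P.val (x - x ^ q ^ (n + 2)) := by
  rw [← map_pow, ← map_mul, ← tangent_pow_identity hq hk h, val_pow_add_self hn hq.one_lt]

/-- The three approximate tangent lines have orders `q`, `0` and `1` at `P`. -/
lemma val_tangents (hq : IsPrimePow q) [Fintype k] (hk : Fintype.card k = q ^ 2)
    (h : HermitianCoords k q x y) (hP : P.degree = 3) (hPx : P.val x ≤ 1)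
    (hPy : P.val y ≤ 1) :
    P.val (y + y ^ q ^ (6 + 1) - x ^ q ^ (6 + 1) * x) = WithZero.exp (-1) ^ q ∧
    P.val (y + y ^ q ^ (8 + 1) - x ^ q ^ (8 + 1) * x) = 1 ∧
    P.val (y + y ^ q ^ (10 + 1) - x ^ q ^ (10 + 1) * x) = WithZero.exp (-1) := by
  have hK : ∀ z : P.residueField, z ^ q ^ 6 = z :=
    fun z => pow_card_residue hk P (by norm_num) hP z
  have hA : ∀ n, P.val (y + y ^ q ^ n - x ^ q ^ n * x) ≤ 1 := fun n =>
    P.val.map_sub_le (P.val.map_add_le hPy (by rw [map_pow]; exact pow_le_one₀ zero_le hPy))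
      (by rw [map_mul, map_pow]; exact mul_le_one' (pow_le_one₀ zero_le hPx) hPx)
  have hD : ∀ n, P.val (x - x ^ q ^ n) ≤ 1 := fun n =>
    P.val.map_sub_le hPx (by rw [map_pow]; exact pow_le_one₀ zero_le hPx)
  have hne := residue_pow_ne hq hk h hP hPx hPy
  have hDiff : ∀ n, P.val (x - x ^ q ^ n) < 1 ↔ IsLocalRing.residue P.integers ⟨x, hPx⟩ =
      IsLocalRing.residue P.integers ⟨x, hPx⟩ ^ q ^ n := by
    intro n
    rw [← map_pow, ← sub_eq_zero, ← map_sub, residue_eq_zero_iff]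
    rfl
  have hLiff : ∀ n, P.val (y + y ^ q ^ n - x ^ q ^ n * x) < 1 ↔
      IsLocalRing.residue P.integers ⟨y, hPy⟩ + IsLocalRing.residue P.integers ⟨y, hPy⟩ ^ q ^ n -
      IsLocalRing.residue P.integers ⟨x, hPx⟩ ^ q ^ n *
        IsLocalRing.residue P.integers ⟨x, hPx⟩ = 0 := by
    intro n
    rw [← map_pow, ← map_pow, ← map_mul, ← map_add, ← map_sub, residue_eq_zero_iff]
    rfl
  have eK : IsLocalRing.residue P.integers ⟨x, hPx⟩ ^ (q + 1) =
      IsLocalRing.residue P.integers ⟨y, hPy⟩ ^ q + IsLocalRing.residue P.integers ⟨y, hPy⟩ := by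
    rw [← map_pow, ← map_pow, ← map_add]
    exact congrArg _ (Subtype.ext h.eqn)
  have d6 : P.val (x - x ^ q ^ 6) = WithZero.exp (-1) :=
    (isAffineAt_of_degree hk (by norm_num) hP hPx hPy).val_eq hq hk h (by norm_num)
  have d6lt : P.val (x - x ^ q ^ 6) < 1 := (hDiff 6).2 (hK _).symm
  -- With u = x - x^(q^6), x - x^(q^12) = u + u^(q^6), and the second term is negligible.
  have d12 : P.val (x - x ^ q ^ 12) = WithZero.exp (-1) := by
    obtain ⟨ψ, hψ⟩ := exists_ringHom_pow hq hk F 6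
    rw [← d6, ← val_pow_add_self d6lt (Nat.one_lt_pow (n := 6) (by norm_num) hq.one_lt), ← hψ,
      map_sub ψ, hψ, hψ, ← pow_mul, ← pow_add]
    congr 1
    ring
  generalize IsLocalRing.residue P.integers ⟨x, hPx⟩ = a at *
  generalize IsLocalRing.residue P.integers ⟨y, hPy⟩ = b at *
  have hstep : ∀ (z : P.residueField) (n : ℕ), z ^ q ^ (6 + n) = z ^ q ^ n := fun z n => by
    rw [pow_add, pow_mul, hK]
  have d8 : P.val (x - x ^ q ^ 8) = 1 := by
    refine le_antisymm (hD 8) (not_lt.1 fun hlt => hne ?_)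
    rw [hDiff, hstep a 2] at hlt
    exact hlt.symm
  -- Since a^(q^6) = a, a residue fixed by the q^4-power map would also be fixed by the q²-power
  -- map.
  have d10 : P.val (x - x ^ q ^ 10) = 1 := by
    refine le_antisymm (hD 10) (not_lt.1 fun hlt => hne ?_)
    rw [hDiff, hstep a 4] at hlt
    conv_lhs => rw [hlt]
    rw [← pow_mul, ← pow_add, hK]
  refine ⟨?_, ?_, ?_⟩
  · rw [val_tangent_of_lt hq hk h, d6, d8, mul_one]
    rw [hLiff, hstep, hstep, pow_one, ← pow_succ, eK]
    ring
  · refine le_antisymm (hA _) (not_lt.1 fun hlt => ?_)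
    have := val_tangent_of_lt hq hk h hlt
    rw [d8, d10, one_pow, one_mul] at this
    exact hlt.ne this
  · rw [val_tangent_of_lt hq hk h, d10, d12, one_pow, one_mul]
    obtain ⟨ψ, hψ⟩ := exists_ringHom_pow hq hk P.residueField 5
    have e := congrArg ψ eK
    have h5 : ∀ z : P.residueField, (z ^ q ^ 5) ^ q = z := fun z => by
      rw [← pow_mul, ← pow_succ, hK]
    rw [map_add, map_pow, map_pow, hψ, hψ, pow_succ, h5, h5] at e
    rw [hLiff, hstep _ 5, hstep _ 5]
    linear_combination -e

/-- The product of the tangent lines at the conjugates of `P` has order `q + 1` at `P`. -/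
lemma val_cubicForm_self (hq : IsPrimePow q) [Fintype k] (hk : Fintype.card k = q ^ 2)
    (h : HermitianCoords k q x y) (hP : P.degree = 3) (hPx : P.val x ≤ 1)
    (hPy : P.val y ≤ 1) {c : Fin 9 → k}
    (hc : ∀ j, algebraMap k P.residueField (c j) =
      lineCoeffs (fun i : Fin 3 => IsLocalRing.residue P.integers ⟨x, hPx⟩ ^ q ^ (2 * i.1 + 1))
        (fun i : Fin 3 => IsLocalRing.residue P.integers ⟨y, hPy⟩ ^ q ^ (2 * i.1 + 1)) j) :
    P.val (cubicForm (fun j => algebraMap k F (c j)) x y 1) =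
      WithZero.exp (-((q : ℤ) + 1)) := by
  obtain ⟨ψ, hψ⟩ := exists_ringHom_pow hq hk F (2 * 3)
  have hsmall : ∀ j, P.val (algebraMap k F (c j) - lineCoeffs (fun i : Fin 3 =>
      x ^ q ^ (2 * i.1 + 1)) (fun i : Fin 3 => y ^ q ^ (2 * i.1 + 1)) j) < 1 := by
    intro j
    have hO := map_lineCoeffs P.integers.subtype
      (fun i : Fin 3 => (⟨x, hPx⟩ : P.integers) ^ q ^ (2 * i.1 + 1))
      (fun i : Fin 3 => (⟨y, hPy⟩ : P.integers) ^ q ^ (2 * i.1 + 1)) j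
    have hR := map_lineCoeffs (IsLocalRing.residue P.integers)
      (fun i : Fin 3 => (⟨x, hPx⟩ : P.integers) ^ q ^ (2 * i.1 + 1))
      (fun i : Fin 3 => (⟨y, hPy⟩ : P.integers) ^ q ^ (2 * i.1 + 1)) j
    simp only [map_pow] at hO hR
    rw [← hc j] at hR
    have hv := (P.hasValue_iff.1 ⟨_, hR⟩).2
    rw [P.val.map_sub_swap]
    convert hv using 3
    exact hO.symm
  have hstep : ∀ (z : F) (i : ℕ), ψ (z ^ q ^ (2 * i + 1)) = z ^ q ^ (6 + 2 * i + 1) := by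
    intro z i
    rw [hψ, ← pow_mul, ← pow_add]
    congr 2
    ring
  -- Raising the congruence modulo P to the power q^6 fixes the constants c j, shifts the Frobenius
  -- exponents by 6, and makes the error of order at least q^6.
  have hclose : ∀ j, P.val (algebraMap k F (c j) - lineCoeffs (fun i : Fin 3 =>
      x ^ q ^ (6 + 2 * i.1 + 1)) (fun i : Fin 3 => y ^ q ^ (6 + 2 * i.1 + 1)) j) ≤
      WithZero.exp (-1) ^ q ^ (2 * 3) := by
    intro j
    have hs := hsmall j
    have e := hψ (algebraMap k F (c j) - lineCoeffs (fun i : Fin 3 =>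
      x ^ q ^ (2 * i.1 + 1)) (fun i : Fin 3 => y ^ q ^ (2 * i.1 + 1)) j)
    rw [map_sub, map_lineCoeffs, hψ, algebraMap_pow_card_pow hk] at e
    simp only [hstep] at e
    rw [e, map_pow]
    refine pow_le_pow_left₀ zero_le ?_ _
    generalize algebraMap k F (c j) - _ = z at hs
    by_cases hz : z = 0
    · simp [hz]
    have hz' := P.val.ne_zero_iff.2 hz
    rw [← WithZero.log_le_iff_le_exp hz']
    rw [← WithZero.exp_zero, ← WithZero.log_lt_iff_lt_exp hz'] at hs
    omega
  have hdiff := val_cubicForm_sub_le hPx hPy hclose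
  obtain ⟨t0, t1, t2⟩ := val_tangents hq hk h hP hPx hPy
  have hprod : P.val (cubicForm (lineCoeffs (fun i : Fin 3 => x ^ q ^ (6 + 2 * i.1 + 1))
      (fun i : Fin 3 => y ^ q ^ (6 + 2 * i.1 + 1))) x y 1) = WithZero.exp (-1) ^ (q + 1) := by
    rw [cubicForm_lineCoeffs, map_mul, map_mul]
    simp only [mul_one]
    refine (congrArg₂ (· * ·) (congrArg₂ (· * ·) t0 t1) t2).trans ?_
    rw [mul_one, pow_succ]
  -- The approximation error has order at least q^6 > q + 1, so it cannot affect the order of the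
  -- cubic.
  have hlt : (WithZero.exp (-1) : ℤᵐ⁰) ^ q ^ (2 * 3) < WithZero.exp (-1) ^ (q + 1) := by
    refine pow_lt_pow_right_of_lt_one₀ WithZero.exp_pos (by
      rw [← WithZero.exp_zero, WithZero.exp_lt_exp]; norm_num) ?_
    have := hq.two_le
    calc q + 1 < q ^ 2 := by nlinarith
      _ ≤ q ^ (2 * 3) := Nat.pow_le_pow_right (by omega) (by norm_num)
  rw [P.val.map_eq_of_sub_lt (hdiff.trans_lt (hlt.trans_eq hprod.symm)), hprod,
    ← WithZero.exp_nsmul]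
  congr 1
  simp

end DegreeThree

/-! ### The principal divisor. -/

/-- The divisor `(q + 1) (P - 3 Q)` is principal if `P` has degree three and `Q` degree one. -/
lemma exists_principal (hq : IsPrimePow q) [Fintype k] (hk : Fintype.card k = q ^ 2)
    (h : HermitianCoords k q x y) {P Pinf : Place k F} (hP : P.degree = 3)
    (hPinf : Pinf.degree = 1) :
    ∃ f : F, f ≠ 0 ∧ P.ord f = q + 1 ∧ Pinf.ord f = -3 * (q + 1) ∧
      ∀ Q : Place k F, Q ≠ P → Q ≠ Pinf → Q.val f = 1 := by
  obtain ⟨x, y, h, hy0, hx, hy⟩ := exists_coords_at_infinity hq hk h hPinf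
  -- Any place where x or y has a pole is the origin in the inverted coordinates, and only one place
  -- lies there.
  have hreg : ∀ Q : Place k F, Q ≠ Pinf → Q.val x ≤ 1 ∧ Q.val y ≤ 1 := by
    intro Q hQ
    by_contra hn
    obtain ⟨h1, h2⟩ := val_eq_of_not_regular hq h hn
    exact hQ (eq_of_origin hq hk (h.inv hy0) h1 h2 hx hy)
  have hPP : P ≠ Pinf := by
    rintro rfl
    omega
  obtain ⟨hPx, hPy⟩ := hreg P hPP
  obtain ⟨c, hc⟩ := exists_cubicForm_coeffs hq hk (pow_card_residue hk P (by norm_num) hP)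
    (IsLocalRing.residue P.integers ⟨x, hPx⟩) (IsLocalRing.residue P.integers ⟨y, hPy⟩)
  have hself := val_cubicForm_self hq hk h hP hPx hPy hc
  have hinf := val_cubicForm_infinity hy0 hx hy c
  refine ⟨cubicForm (fun j => algebraMap k F (c j)) x y 1, ?_, ?_, ?_, fun Q hQ hQ' =>
    val_cubicForm_eq_one hq hk h hP hPx hPy (hreg Q hQ').1 (hreg Q hQ').2 hQ.symm hc⟩
  · rw [← P.val.ne_zero_iff, hself]
    exact WithZero.exp_ne_zero
  · rw [ord, hself, WithZero.log_exp]
    ring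
  · have hv := (val_of_origin hq hk (h.inv hy0) hx hy).2
    rw [map_div₀, map_one, one_div] at hv
    have hl := congrArg WithZero.log hv
    rw [WithZero.log_inv, WithZero.log_exp] at hl
    rw [ord, hinf, WithZero.log_pow, nsmul_eq_mul]
    push_cast
    linarith

end Place

/-! ### From principal divisors to monomial equivalence. -/

section MonomialEquivalence

variable {k F : Type*} [Field k] [Field F] [Algebra k F]

lemma Place.ord_mul (Q : Place k F) {f g : F} (hf : f ≠ 0) (hg : g ≠ 0) :
    Q.ord (f * g) = Q.ord f + Q.ord g := by
  rw [Place.ord, map_mul, WithZero.log_mul (Q.val.ne_zero_iff.2 hf) (Q.val.ne_zero_iff.2 hg)]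
  unfold Place.ord
  ring

lemma Place.HasValue.mul {Q : Place k F} {f g : F} {a b : k} (hf : Q.HasValue f a)
    (hg : Q.HasValue g b) : Q.HasValue (f * g) (a * b) := by
  obtain ⟨h, e⟩ := hf
  obtain ⟨h', e'⟩ := hg
  refine ⟨mul_mem h h', ?_⟩
  rw [map_mul, ← e, ← e', ← map_mul]
  rfl

lemma mul_mem_riemannRochSpace {A B : PlaceDivisor k F} {f g : F} (hg : g ≠ 0)
    (h : ∀ Q, A Q - B Q ≤ Q.ord g) (hf : f ∈ riemannRochSpace A) :
    f * g ∈ riemannRochSpace B := by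
  intro hfg Q
  have hf0 := left_ne_zero_of_mul hfg
  have h1 := hf hf0 Q
  have h2 := h Q
  rw [Q.ord_mul hf0 hg]
  linarith

/-- Functional codes of divisors differing by the divisor of a function that is a unit at all
evaluation places are monomially equivalent. -/
lemma monomiallyEquivalent_of_principal {S : Set (Place k F)} {A B : PlaceDivisor k F} {g : F}
    (hg : g ≠ 0) (hS : ∀ Q ∈ S, Q.degree = 1 ∧ Q.val g = 1) (h : ∀ Q, A Q - B Q = Q.ord g) :
    MonomiallyEquivalent (functionalCode S A) (functionalCode S B) := by
  have hex : ∀ Q : S, ∃ c : kˣ, Q.1.HasValue g (c : k) ∧ Q.1.HasValue g⁻¹ ((c⁻¹ : kˣ) : k) := by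
    intro Q
    obtain ⟨hd, hv⟩ := hS Q.1 Q.2
    have hv' : Q.1.val g⁻¹ = 1 := by rw [map_inv₀, hv, inv_one]
    obtain ⟨c, hc⟩ := Place.exists_val_sub_lt hd hv.le
    obtain ⟨d, hd⟩ := Place.exists_val_sub_lt hd hv'.le
    have hc' := Q.1.hasValue_iff.2 ⟨hv.le, hc⟩
    have hd' := Q.1.hasValue_iff.2 ⟨hv'.le, hd⟩
    have h1 := (Q.1.hasValue_iff.1 (hc'.mul hd')).2
    rw [mul_inv_cancel₀ hg, ← map_one (algebraMap k F), ← map_sub,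
      Q.1.val_algebraMap_lt_one_iff, sub_eq_zero] at h1
    exact ⟨⟨c, d, h1.symm, by rw [mul_comm, ← h1]⟩, hc', hd'⟩
  choose u hu hu' using hex
  -- No permutation is needed; the scalars are the values of g.
  refine ⟨1, u, fun c => ⟨?_, ?_⟩⟩
  · rintro ⟨f, hf, hv⟩
    refine ⟨f * g, mul_mem_riemannRochSpace hg (fun Q => (h Q).le) hf, fun Q => ?_⟩
    rw [mul_comm f]
    exact (hu Q).mul (hv Q)
  · rintro ⟨f, hf, hv⟩
    have hinv : ∀ Q : Place k F, Q.ord g⁻¹ = -Q.ord g := fun Q => by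
      rw [Place.ord, Place.ord, map_inv₀, WithZero.log_inv]
    refine ⟨f * g⁻¹, mul_mem_riemannRochSpace (inv_ne_zero hg) (fun Q => ?_) hf, fun Q => ?_⟩
    · rw [hinv, ← h Q]
      linarith
    · have := (hu' Q).mul (hv Q)
      simp only [Equiv.Perm.one_apply, Units.inv_mul_cancel_left] at this
      rwa [mul_comm f]

end MonomialEquivalence

theorem mainTheorem6 (q : ℕ) [Fact (IsPrimePow q)] (k : Type*) [Field k] [Fintype k]
    (hk : Fintype.card k = q ^ 2) (m m₁ m₀ : ℕ) (hm : m = m₁ * (q + 1) + m₀) (hm₀ : m₀ ≤ q)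
    (P Pinf : Place k (Hermitian.FunctionField q k))
    (hP : P.degree = 3) (hPinf : Pinf.degree = 1) :
    MonomiallyEquivalent
      (functionalCode {Q : Place k (Hermitian.FunctionField q k) | Q.degree = 1 ∧ Q ≠ Pinf}
        (Finsupp.single Pinf ((q : ℤ) ^ 3 + (q : ℤ) ^ 2 - q - 2) - Finsupp.single P (m : ℤ)))
      (functionalCode {Q : Place k (Hermitian.FunctionField q k) | Q.degree = 1 ∧ Q ≠ Pinf}
        (Finsupp.single Pinf (((q : ℤ) ^ 2 - 3 * (m₁ : ℤ) - 1) * ((q : ℤ) + 1))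
          - (Finsupp.single Pinf 1 + Finsupp.single P (m₀ : ℤ)))) := by
  classical
  have hq : IsPrimePow q := Fact.out
  obtain ⟨x, y, h⟩ := Hermitian.exists_coords q k
  obtain ⟨f, hf0, hfP, hfinf, hf1⟩ := Place.exists_principal hq hk h hP hPinf
  have hPP : P ≠ Pinf := by
    rintro rfl
    omega
  have hord : ∀ Q : Place k (Hermitian.FunctionField q k), Q.ord (f ^ m₁)⁻¹ = -(m₁ * Q.ord f) := by
    intro Q
    rw [Place.ord, Place.ord, map_inv₀, map_pow, WithZero.log_inv, WithZero.log_pow, nsmul_eq_mul]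
    ring
  -- Since m - m₀ = m₁ (q + 1), the difference of the divisors is -m₁ div f. P has degree three, so
  -- it is not an evaluation place.
  refine monomiallyEquivalent_of_principal (g := (f ^ m₁)⁻¹) (inv_ne_zero (pow_ne_zero _ hf0))
    (fun Q hQ => ⟨hQ.1, ?_⟩) fun Q => ?_
  · have hQP : Q ≠ P := by
      rintro rfl
      have := hQ.1
      omega
    rw [map_inv₀, map_pow, hf1 Q hQP hQ.2, one_pow, inv_one]
  · rw [hord]
    simp only [Finsupp.sub_apply, Finsupp.add_apply, Finsupp.single_apply]
    by_cases h1 : Q = P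
    · subst h1
      rw [hfP, if_neg hPP.symm, if_neg hPP.symm, if_neg hPP.symm, if_pos rfl, if_pos rfl, hm]
      push_cast
      ring
    by_cases h2 : Q = Pinf
    · subst h2
      rw [hfinf, if_neg hPP, if_neg hPP, if_pos rfl, if_pos rfl, if_pos rfl]
      ring
    · have : Q.ord f = 0 := by rw [Place.ord, hf1 Q h1 h2, WithZero.log_one, neg_zero]
      rw [this, if_neg (Ne.symm h1), if_neg (Ne.symm h1), if_neg (Ne.symm h2),
        if_neg (Ne.symm h2), if_neg (Ne.symm h2)]
      ring
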